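/- Let $\mathcal{S}_{\mathrm{per}}$ be the space of all $f\in C^\infty(\mathbb{R}^2;\mathbb{C})$, $f=f(t,x)$, with $f(t,x+2\pi)=f(t,x)$ and $\sup_{t,x}|t|^k|\partial_t^m\partial_x^n f(t,x)|<\infty$ for all $k,m,n\ge 0$. For $\tau\in\mathbb{R}$, $\xi\in\mathbb{Z}$ put $\mathcal{F}f(\tau,\xi)=\frac{1}{2\pi}\int_{\mathbb{R}}\int_0^{2\pi}e^{-it\tau-ix\xi}f(t,x)\,dx\,dt$, write $\langle a\rangle=(1+|a|^2)^{1/2}$, and for $s,b\in\mathbb{R}$ define $$\|f\|_{X_{s,b}}^2=\sum_{\xi\in\mathbb{Z}}\int_{\mathbb{R}}\langle\xi\rangle^{2s}\langle\tau+\xi^2\rangle^{2b}|\mathcal{F}f(\tau,\xi)|^2\,d\tau,\qquad \|f\|_{X^-_{s,b}}^2=\sum_{\xi\in\mathbb{Z}}\int_{\mathbb{R}}\langle\xi\rangle^{2s}\langle\tau-\xi^2\rangle^{2b}|\mathcal{F}f(\tau,\xi)|^2\,d\tau .$$ There exist $c,\varepsilon>0$ such that for every $T\in(0,1]$ and all $u_1,u_2,u_3\in\mathcal{S}_{\mathrm{per}}$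 with $\operatorname{supp}(u_j)\subset\{(t,x): |t|\le T\}$ for $j=1,2,3$, $$\|u_1u_2\,\partial_xu_3\|_{X_{\frac12,-\frac12}}\le c\,T^{\varepsilon}\,\|u_1\|_{X_{\frac12,\frac12}}\|u_2\|_{X_{\frac12,\frac12}}\|u_3\|_{X^-_{\frac12,\frac12}} .$$ -/

import Mathlib

open scoped ENNReal ContDiff

noncomputable section

namespace PeriodicBourgain

/-- The space `S_per`: smooth complex-valued functions of `(t, x) ∈ ℝ²`, `2π`-periodic in `x`,
which together with all their derivatives decay rapidly in `t`, uniformly in `x`. -/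
structure IsSPer (f : ℝ → ℝ → ℂ) : Prop where
  periodic : ∀ t x : ℝ, f t (x + 2 * Real.pi) = f t x
  smooth : ContDiff ℝ ∞ (fun p : ℝ × ℝ => f p.1 p.2)
  decay : ∀ k n : ℕ, ∃ C : ℝ, ∀ t x : ℝ,
    |t| ^ k * ‖iteratedFDeriv ℝ n (fun p : ℝ × ℝ => f p.1 p.2) (t, x)‖ ≤ C

/-- Fourier coefficient of a `2π`-periodic function,
`(2π)^{-1/2} ∫_0^{2π} e^{-i x ξ} g(x) dx` for `ξ ∈ ℤ`. -/
def fourierX (g : ℝ → ℂ) (ξ : ℤ) : ℂ :=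
  (((2 * Real.pi) ^ (-(1 / 2) : ℝ) : ℝ) : ℂ) *
    ∫ x in (0 : ℝ)..(2 * Real.pi), Complex.exp (-(Complex.I * (x : ℂ) * (ξ : ℂ))) * g x

/-- Fourier transform in time, `(2π)^{-1/2} ∫_ℝ e^{-i t τ} g(t) dt`. -/
def fourierT (g : ℝ → ℂ) (τ : ℝ) : ℂ :=
  (((2 * Real.pi) ^ (-(1 / 2) : ℝ) : ℝ) : ℂ) *
    ∫ t : ℝ, Complex.exp (-(Complex.I * (t : ℂ) * (τ : ℂ))) * g t

/-- Space-time Fourier transform at `(τ, ξ) ∈ ℝ × ℤ`. -/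
def fourierTX (f : ℝ → ℝ → ℂ) (τ : ℝ) (ξ : ℤ) : ℂ :=
  fourierT (fun t => fourierX (f t) ξ) τ

/-- The bracket `⟨a⟩ = (1 + |a|²)^{1/2}`. -/
def bracket (a : ℝ) : ℝ := Real.sqrt (1 + |a| ^ 2)

/-- The norm of `X_{s,b}`, with weight `⟨τ + ξ²⟩`, as an extended nonnegative real. -/
def normX (s b : ℝ) (f : ℝ → ℝ → ℂ) : ℝ≥0∞ :=
  (∑' ξ : ℤ, ∫⁻ τ : ℝ, ENNReal.ofReal
    (bracket (ξ : ℝ) ^ (2 * s) * bracket (τ + (ξ : ℝ) ^ 2) ^ (2 * b) *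
      ‖fourierTX f τ ξ‖ ^ 2)) ^ (1 / 2 : ℝ)

/-- The norm of `X⁻_{s,b}`, with weight `⟨τ - ξ²⟩`, as an extended nonnegative real. -/
def normXMinus (s b : ℝ) (f : ℝ → ℝ → ℂ) : ℝ≥0∞ :=
  (∑' ξ : ℤ, ∫⁻ τ : ℝ, ENNReal.ofReal
    (bracket (ξ : ℝ) ^ (2 * s) * bracket (τ - (ξ : ℝ) ^ 2) ^ (2 * b) *
      ‖fourierTX f τ ξ‖ ^ 2)) ^ (1 / 2 : ℝ)

end PeriodicBourgain

end

noncomputable section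

namespace PeriodicBourgain

open MeasureTheory

/-! ### Powers of the bracket -/

/-! By duality the estimate becomes a bound for a quadrilinear form over frequencies `p₀ + p₃ = p₁ +
p₂` in `ℤ × ℝ`, where `p₃` is minus the frequency of `u₃`. This reflection turns the weight of `X⁻`
into the modulation `σ = τ + ξ²` used for the other factors. Two identities drive the proof: `ξ₀ξ₃ =
ξ₁ξ₂ - (ξ₀ - ξ₁)(ξ₀ - ξ₂)` and `σ₀ - σ₁ - σ₂ + σ₃ = 2(ξ₀ - ξ₁)(ξ₀ - ξ₂)`. The first bounds the
squared ratio of Sobolev weights, derivative included, by a constant plus a multiple of `|(ξ₀ -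
ξ₁)(ξ₀ - ξ₂)| / (⟨ξ₁⟩⟨ξ₂⟩)`; the second bounds that product by the modulations (`multiplier_le`).

Hence the kernel is dominated by one term with no frequency loss and all four weights `⟨σ⟩^(-1/2)`,
and four terms in which one modulation weight is spent but `⟨ξ₁⟩^(-1/2) ⟨ξ₂⟩^(-1/2)` remains. The
first is two applications of the periodic `L⁴` Strichartz estimate (`boundedKernel_kernelUnit`). The
others follow from Cauchy–Schwarz once the squared kernel, with one frequency fixed, has a bounded
integral. If `σ₀` or `σ₃` is spent, the doubly divergent sum over `ξ₁, ξ₂` is saved by the nonzero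
slope of the remaining phase (`boundedKernel_kernelZero`); if `σ₁` or `σ₂` is spent, by comparing
the surviving one of these two modulations with its frequency (`boundedKernel_kernelOne`).

All these bounds hold already with `⟨σ⟩^(-49/100)`. The spare `⟨σ⟩^(-1/100)` on `u₁` or `u₂` yields
the power of `T`: a function supported in `|t| ≤ T` cannot have most of its Fourier mass in an
interval much shorter than `1/T` (`sqNorm_gain`). -/

theorem one_le_bracket (x : ℝ) : 1 ≤ bracket x := by
  unfold bracket
  rw [Real.one_le_sqrt]
  have := sq_nonneg |x|
  linarith

theorem bracket_pos (x : ℝ) : 0 < bracket x := lt_of_lt_of_le one_pos (one_le_bracket x)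

theorem bracket_sq (x : ℝ) : bracket x ^ 2 = 1 + x ^ 2 := by
  unfold bracket
  rw [Real.sq_sqrt (by positivity), sq_abs]

theorem bracket_neg (x : ℝ) : bracket (-x) = bracket x := by simp [bracket]

theorem abs_le_bracket (x : ℝ) : |x| ≤ bracket x :=
  abs_le_of_sq_le_sq' (by rw [bracket_sq, sq_abs]; linarith) (bracket_pos x).le |>.2

theorem bracket_le_one_add_abs (x : ℝ) : bracket x ≤ 1 + |x| := by
  refine abs_le_of_sq_le_sq' ?_ (by positivity) |>.2
  rw [bracket_sq, ← sq_abs x]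
  nlinarith [abs_nonneg x]

theorem bracket_mono {x y : ℝ} (h : |x| ≤ |y|) : bracket x ≤ bracket y := by
  unfold bracket
  gcongr

theorem bracket_add_le (x y : ℝ) : bracket (x + y) ≤ bracket x + bracket y := by
  have hx := one_le_bracket x
  have hy := one_le_bracket y
  refine abs_le_of_sq_le_sq' ?_ (by positivity) |>.2
  have h1 : x * y ≤ bracket x * bracket y := by
    calc x * y ≤ |x * y| := le_abs_self _
      _ = |x| * |y| := abs_mul _ _
      _ ≤ _ := by gcongr <;> exact abs_le_bracket _
  have h2 := bracket_sq x
  have h3 := bracket_sq y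
  rw [bracket_sq]
  nlinarith

/-- The power `⟨x⟩ ^ p` as an extended nonnegative real. -/
def jap (p x : ℝ) : ℝ≥0∞ := ENNReal.ofReal (bracket x ^ p)

theorem measurable_bracket : Measurable bracket := by
  unfold bracket
  fun_prop

@[fun_prop]
theorem measurable_jap (p : ℝ) : Measurable (jap p) := by
  unfold jap
  exact (measurable_bracket.pow_const p).ennreal_ofReal

theorem jap_ne_top (p x : ℝ) : jap p x ≠ ⊤ := ENNReal.ofReal_ne_top

theorem jap_neg_arg (p x : ℝ) : jap p (-x) = jap p x := by simp [jap, bracket_neg]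

theorem jap_sub_comm (p x y : ℝ) : jap p (x - y) = jap p (y - x) := by
  rw [← jap_neg_arg, neg_sub]

theorem jap_add (p q x : ℝ) : jap (p + q) x = jap p x * jap q x := by
  unfold jap
  rw [Real.rpow_add (bracket_pos x), ENNReal.ofReal_mul (by have := bracket_pos x; positivity)]

theorem jap_zero (x : ℝ) : jap 0 x = 1 := by simp [jap]

theorem jap_pow_two (p x : ℝ) : jap p x ^ 2 = jap (2 * p) x := by
  rw [two_mul, jap_add, sq]

theorem jap_mono_exp {p q : ℝ} (h : p ≤ q) (x : ℝ) : jap p x ≤ jap q x :=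
  ENNReal.ofReal_le_ofReal (Real.rpow_le_rpow_of_exponent_le (one_le_bracket x) h)

theorem jap_mono_bracket {p x y : ℝ} (hp : 0 ≤ p) (h : bracket x ≤ bracket y) :
    jap p x ≤ jap p y :=
  ENNReal.ofReal_le_ofReal (Real.rpow_le_rpow (bracket_pos x).le h hp)

theorem jap_anti_bracket {p x y : ℝ} (hp : 0 ≤ p) (h : bracket x ≤ bracket y) :
    jap (-p) y ≤ jap (-p) x :=
  ENNReal.ofReal_le_ofReal (Real.rpow_le_rpow_of_nonpos (bracket_pos x) h (by linarith))

theorem jap_anti_const_mul {p x y K : ℝ} (hp : 0 ≤ p) (hK : 0 < K)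
    (h : bracket x ≤ K * bracket y) :
    jap (-p) y ≤ ENNReal.ofReal (K ^ p) * jap (-p) x := by
  have hx := bracket_pos x
  have hy := bracket_pos y
  unfold jap
  rw [← ENNReal.ofReal_mul (by positivity)]
  refine ENNReal.ofReal_le_ofReal ?_
  rw [Real.rpow_neg hy.le, Real.rpow_neg hx.le, inv_eq_one_div, ← div_eq_mul_inv,
    div_le_div_iff₀ (by positivity) (by positivity), one_mul, ← Real.mul_rpow hK.le hy.le]
  exact Real.rpow_le_rpow hx.le h hp

/-- Moving decay between two factors. -/
theorem jap_mul_jap_le {p q p' q' : ℝ} (h : p + q = p' + q') (h1 : p ≤ p') (h2 : q' ≤ p)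
    (x y : ℝ) :
    jap (-p) x * jap (-q) y ≤ jap (-p') x * jap (-q') y + jap (-q') x * jap (-p') y := by
  rcases le_total (bracket x) (bracket y) with hxy | hxy
  · refine le_trans ?_ le_self_add
    have e1 : jap (-p) x = jap (-p') x * jap (p' - p) x := by rw [← jap_add]; ring_nf
    have e2 : jap (-q') y = jap (p' - p) y * jap (-q) y := by
      rw [← jap_add]; congr 1; linarith
    rw [e1, e2, mul_assoc]
    gcongr
    exact jap_mono_bracket (by linarith) hxy
  · refine le_trans ?_ le_add_self
    have e1 : jap (-q') x = jap (-p) x * jap (p - q') x := by rw [← jap_add]; ring_nf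
    have e2 : jap (-q) y = jap (p - q') y * jap (-p') y := by
      rw [← jap_add]; congr 1; linarith
    rw [e1, e2, mul_assoc]
    gcongr
    exact jap_mono_bracket (by linarith) hxy

theorem jap_mul_jap_le_add {p q : ℝ} (hp : 0 ≤ p) (hq : 0 ≤ q) (x y : ℝ) :
    jap (-p) x * jap (-q) y ≤ jap (-(p + q)) x + jap (-(p + q)) y := by
  simpa [jap_zero] using
    jap_mul_jap_le (p := p) (q := q) (p' := p + q) (q' := 0) (by ring) (by linarith) hp x y

/-! ### Integrals and sums of powers of the bracket -/

theorem lintegral_jap_lt_top {p : ℝ} (hp : 1 < p) : ∫⁻ x : ℝ, jap (-p) x < ⊤ := by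
  have h := integrable_rpow_neg_one_add_norm_sq (E := ℝ) (μ := volume) (r := p) (by simpa using hp)
  have h2 := h.lintegral_lt_top
  refine lt_of_le_of_lt (lintegral_mono fun x => ?_) h2
  unfold jap
  refine ENNReal.ofReal_le_ofReal (le_of_eq ?_)
  unfold bracket
  rw [Real.sqrt_eq_rpow, ← Real.rpow_mul (by positivity), Real.norm_eq_abs]
  congr 1
  ring

theorem lintegral_jap_add (p a : ℝ) : ∫⁻ x : ℝ, jap p (x + a) = ∫⁻ x : ℝ, jap p x :=
  lintegral_add_right_eq_self (fun x => jap p x) a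

theorem lintegral_jap_sub_left (p a : ℝ) : ∫⁻ x : ℝ, jap p (a - x) = ∫⁻ x : ℝ, jap p x :=
  lintegral_sub_left_eq_self (fun x => jap p x) a

/-- The larger of the two brackets is at least `⟨b - a⟩ / 2`. Its power `r` is pulled out of the
integral, and the remaining total exponent `p + q - r > 1` is integrable. -/
theorem exists_lintegral_jap_mul_jap_le {p q r : ℝ} (hr : 0 ≤ r) (hrp : r ≤ p) (hrq : r ≤ q)
    (h : 1 < p + q - r) :
    ∃ C : ℝ≥0∞, C ≠ ⊤ ∧ ∀ a b : ℝ,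
      ∫⁻ x : ℝ, jap (-p) (x + a) * jap (-q) (x + b) ≤ C * jap (-r) (b - a) := by
  set I := ∫⁻ x : ℝ, jap (-(p + q - r)) x with hI
  have hIt : I ≠ ⊤ := (lintegral_jap_lt_top h).ne
  refine ⟨ENNReal.ofReal (2 ^ r) * (4 * I), by finiteness, fun a b => ?_⟩
  have key : ∀ x, jap (-p) (x + a) * jap (-q) (x + b) ≤
      (2 * (ENNReal.ofReal (2 ^ r) * jap (-r) (b - a))) *
        (jap (-(p + q - r)) (x + a) + jap (-(p + q - r)) (x + b)) := by
    intro x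
    have hb : bracket (b - a) ≤ bracket (x + b) + bracket (x + a) := by
      have := bracket_add_le (x + b) (-(x + a))
      rw [bracket_neg] at this
      convert this using 2
      ring
    rcases le_total (bracket (x + a)) (bracket (x + b)) with hxy | hxy
    · have h1 : jap (-r) (x + b) ≤ ENNReal.ofReal (2 ^ r) * jap (-r) (b - a) :=
        jap_anti_const_mul hr two_pos (by linarith)
      have h2 := jap_mul_jap_le_add (p := p) (q := q - r) (by linarith) (by linarith)
        (x + a) (x + b)
      have e : jap (-q) (x + b) = jap (-r) (x + b) * jap (-(q - r)) (x + b) := by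
        rw [← jap_add]; ring_nf
      rw [show p + (q - r) = p + q - r by ring] at h2
      calc _ = jap (-r) (x + b) * (jap (-p) (x + a) * jap (-(q - r)) (x + b)) := by rw [e]; ring
        _ ≤ _ := by
          gcongr
          exact h1.trans (le_mul_of_one_le_left (by positivity) (by norm_num))
    · have h1 : jap (-r) (x + a) ≤ ENNReal.ofReal (2 ^ r) * jap (-r) (b - a) :=
        jap_anti_const_mul hr two_pos (by linarith)
      have h2 := jap_mul_jap_le_add (p := p - r) (q := q) (by linarith) (by linarith)
        (x + a) (x + b)
      have e : jap (-p) (x + a) = jap (-r) (x + a) * jap (-(p - r)) (x + a) := by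
        rw [← jap_add]; ring_nf
      rw [show p - r + q = p + q - r by ring] at h2
      calc _ = jap (-r) (x + a) * (jap (-(p - r)) (x + a) * jap (-q) (x + b)) := by rw [e]; ring
        _ ≤ _ := by
          gcongr
          exact h1.trans (le_mul_of_one_le_left (by positivity) (by norm_num))
  calc _ ≤ _ := lintegral_mono key
    _ = (2 * (ENNReal.ofReal (2 ^ r) * jap (-r) (b - a))) * (I + I) := by
      rw [lintegral_const_mul _ (by fun_prop), lintegral_add_left (by fun_prop),
        lintegral_jap_add, lintegral_jap_add]
    _ = _ := by ring

theorem tsum_jap_int_lt_top {p : ℝ} (hp : 1 < p) : ∑' n : ℤ, jap (-p) n < ⊤ := by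
  have h := Real.summable_abs_int_rpow hp
  -- In Lean `|0| ^ (-p)` is `0`, so the term `n = 0` needs a summand of its own.
  have h0 : ∀ n : ℤ, jap (-p) n ≤ ENNReal.ofReal (|(n : ℝ)| ^ (-p)) + if n = 0 then 1 else 0 := by
    intro n
    by_cases hn : n = 0
    · subst hn
      simp only [if_true]
      refine le_trans ?_ le_add_self
      have := jap_mono_exp (show -p ≤ 0 by linarith) ((0 : ℤ) : ℝ)
      rwa [jap_zero] at this
    · refine le_trans ?_ le_self_add
      exact ENNReal.ofReal_le_ofReal (Real.rpow_le_rpow_of_nonpos (by simpa using hn)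
        (abs_le_bracket _) (by linarith))
  refine lt_of_le_of_lt (ENNReal.tsum_le_tsum h0) ?_
  rw [ENNReal.tsum_add, tsum_ite_eq]
  have := h.tsum_ofReal_lt_top
  finiteness

/-- Translating by `⌊D⌋` reduces to a shift in `[0, 1)`, which changes brackets only by a bounded
factor. -/
theorem exists_tsum_jap_add_le {p : ℝ} (hp : 1 < p) :
    ∃ C : ℝ≥0∞, C ≠ ⊤ ∧ ∀ D : ℝ, ∑' n : ℤ, jap (-p) (n + D) ≤ C := by
  refine ⟨ENNReal.ofReal (2 ^ p) * ENNReal.ofReal (2 ^ p) * ∑' n : ℤ, jap (-p) n,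
    ENNReal.mul_ne_top (by finiteness) (tsum_jap_int_lt_top hp).ne, fun D => ?_⟩
  have e : ∑' n : ℤ, jap (-p) (n + D) = ∑' n : ℤ, jap (-p) (n + Int.fract D) := by
    rw [← (Equiv.addRight ⌊D⌋).tsum_eq (fun n : ℤ => jap (-p) (n + Int.fract D))]
    congr 1
    ext n
    congr 1
    have := Int.floor_add_fract D
    simp only [Equiv.coe_addRight, Int.cast_add]
    linarith
  rw [e, ← ENNReal.tsum_mul_left]
  refine ENNReal.tsum_le_tsum fun n => ?_
  -- The triangle inequality gives the factor 3; the 4 matches the constant `2 ^ p * 2 ^ p`.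
  have hb : bracket n ≤ 4 * bracket (n + Int.fract D) := by
    have h1 := bracket_add_le (n + Int.fract D) (-Int.fract D)
    have h2 := bracket_le_one_add_abs (-Int.fract D)
    have h3 := one_le_bracket (n + Int.fract D)
    rw [abs_neg, abs_of_nonneg (Int.fract_nonneg D)] at h2
    have h4 := Int.fract_lt_one D
    rw [add_neg_cancel_right] at h1
    linarith
  have := jap_anti_const_mul (p := p) (by linarith) (by norm_num) hb
  rw [← ENNReal.ofReal_mul (by positivity), ← Real.mul_rpow (by norm_num) (by norm_num)]
  norm_num1
  exact this

theorem bracket_le_of_abs_le_mul {x y K : ℝ} (hK : 1 ≤ K) (h : |x| ≤ K * |y|) :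
    bracket x ≤ K * bracket y := by
  have hy := bracket_pos y
  refine abs_le_of_sq_le_sq' ?_ (by positivity) |>.2
  rw [mul_pow, bracket_sq, bracket_sq]
  have : x ^ 2 ≤ K ^ 2 * y ^ 2 := by
    rw [← sq_abs x, ← sq_abs y, ← mul_pow]
    gcongr
  nlinarith

/-- In `y² - D² = (y - D)(y + D)` the smaller factor has square at most `|y² - D²|`, so decay `r` in
the product is decay `2r` in the distance to the nearer root. -/
theorem jap_sub_sq_le {r : ℝ} (hr : 0 ≤ r) (D y : ℝ) (hD : 0 ≤ D) :
    jap (-r) (y ^ 2 - D ^ 2) ≤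
      ENNReal.ofReal (2 ^ r) * (jap (-(2 * r)) (y - D) + jap (-(2 * r)) (y + D)) := by
  have aux : ∀ z : ℝ, z ^ 2 ≤ |y ^ 2 - D ^ 2| →
      jap (-r) (y ^ 2 - D ^ 2) ≤ ENNReal.ofReal (2 ^ r) * jap (-(2 * r)) z := by
    intro z hz
    have hb : bracket z ^ 2 ≤ 2 * bracket (y ^ 2 - D ^ 2) := by
      rw [bracket_sq]
      have h1 := abs_le_bracket (y ^ 2 - D ^ 2)
      have h2 := one_le_bracket (y ^ 2 - D ^ 2)
      linarith
    have hz0 := bracket_pos z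
    have hy0 := bracket_pos (y ^ 2 - D ^ 2)
    unfold jap
    rw [← ENNReal.ofReal_mul (by positivity)]
    refine ENNReal.ofReal_le_ofReal ?_
    rw [← mul_neg, Real.rpow_mul hz0.le, Real.rpow_two, Real.rpow_neg hy0.le,
      Real.rpow_neg (by positivity), inv_eq_one_div, ← div_eq_mul_inv,
      div_le_div_iff₀ (by positivity) (by positivity), one_mul, ← Real.mul_rpow (by norm_num) hy0.le]
    exact Real.rpow_le_rpow (by positivity) hb hr
  rw [mul_add]
  rcases le_total 0 y with hy | hy
  · refine le_trans (aux (y - D) ?_) le_self_add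
    rw [sq_sub_sq, abs_mul, ← sq_abs (y - D), sq]
    refine mul_le_mul_of_nonneg_right ?_ (abs_nonneg _)
    rw [abs_of_nonneg (by linarith : 0 ≤ y + D), abs_le]
    constructor <;> linarith
  · refine le_trans (aux (y + D) ?_) le_add_self
    rw [sq_sub_sq, abs_mul, ← sq_abs (y + D), sq]
    refine mul_le_mul_of_nonneg_left ?_ (abs_nonneg _)
    rw [abs_of_nonpos (by linarith : y - D ≤ 0), abs_le]
    constructor <;> linarith

theorem exists_tsum_jap_add_sq_le {r : ℝ} (hr : 1 / 2 < r) :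
    ∃ C : ℝ≥0∞, C ≠ ⊤ ∧ ∀ A : ℝ, ∑' n : ℤ, jap (-r) (A + (n : ℝ) ^ 2) ≤ C := by
  obtain ⟨C, hC, h⟩ := exists_tsum_jap_add_le (p := 2 * r) (by linarith)
  refine ⟨ENNReal.ofReal (2 ^ r) * (C + C), by finiteness, fun A => ?_⟩
  -- For `A ≤ 0` this is the nonnegative root of `A + y²`. For `A ≥ 0` it is `0`, and `n² ≤ A + n²`
  -- suffices.
  set D := √(max (-A) 0) with hD
  have hD2 : D ^ 2 = max (-A) 0 := Real.sq_sqrt (le_max_right _ _)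
  have hD0 : 0 ≤ D := Real.sqrt_nonneg _
  have key : ∀ n : ℤ, jap (-r) (A + (n : ℝ) ^ 2) ≤
      ENNReal.ofReal (2 ^ r) * (jap (-(2 * r)) (n + -D) + jap (-(2 * r)) (n + D)) := by
    intro n
    refine le_trans ?_ (jap_sub_sq_le (by linarith) D n hD0)
    refine jap_anti_bracket (by linarith) (bracket_mono ?_)
    rw [hD2]
    rcases le_total A 0 with hA | hA
    · rw [max_eq_left (by linarith)]
      apply le_of_eq
      ring_nf
    · rw [max_eq_right (by linarith), sub_zero, abs_of_nonneg (sq_nonneg _),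
        abs_of_nonneg (by positivity)]
      linarith
  calc _ ≤ _ := ENNReal.tsum_le_tsum key
    _ = ENNReal.ofReal (2 ^ r) * (∑' n : ℤ, jap (-(2 * r)) (n + -D) +
          ∑' n : ℤ, jap (-(2 * r)) (n + D)) := by rw [ENNReal.tsum_mul_left, ENNReal.tsum_add]
    _ ≤ _ := by gcongr <;> exact h _

/-- Completing the square, `2(A + 2k² + 2hk) = 2A - h² + (2k + h)²`, and `k ↦ 2k + h` is injective,
so the sum is part of one already bounded. -/
theorem exists_tsum_jap_quadratic_le {r : ℝ} (hr : 1 / 2 < r) :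
    ∃ C : ℝ≥0∞, C ≠ ⊤ ∧ ∀ (A : ℝ) (h : ℤ),
      ∑' k : ℤ, jap (-r) (A + 2 * (k : ℝ) ^ 2 + 2 * h * k) ≤ C := by
  obtain ⟨C, hC, hs⟩ := exists_tsum_jap_add_sq_le hr
  refine ⟨ENNReal.ofReal (2 ^ r) * C, by finiteness, fun A h => ?_⟩
  have hinj : Function.Injective (fun k : ℤ => 2 * k + h) := by
    intro a b hab
    simp only at hab
    omega
  calc _ ≤ ∑' k : ℤ, ENNReal.ofReal (2 ^ r) *
        jap (-r) (2 * A - (h : ℝ) ^ 2 + ((2 * k + h : ℤ) : ℝ) ^ 2) := by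
        refine ENNReal.tsum_le_tsum fun k => jap_anti_const_mul (by linarith) two_pos ?_
        refine bracket_le_of_abs_le_mul one_le_two (le_of_eq ?_)
        rw [← abs_two (α := ℝ), ← abs_mul, abs_two]
        push_cast
        ring_nf
    _ = ENNReal.ofReal (2 ^ r) * ∑' k : ℤ,
        jap (-r) (2 * A - (h : ℝ) ^ 2 + ((2 * k + h : ℤ) : ℝ) ^ 2) := ENNReal.tsum_mul_left
    _ ≤ _ := by
        gcongr
        exact (ENNReal.tsum_comp_le_tsum_of_injective hinj
          (fun n : ℤ => jap (-r) (2 * A - (h : ℝ) ^ 2 + (n : ℝ) ^ 2))).trans (hs _)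

/-- A nonzero integer slope gives `|A + 2bk| ≥ |k + A/(2b)|`, so the two decays combine to the
summable exponent `p + r`, uniformly in `A` and `b`. -/
theorem exists_tsum_jap_mul_jap_linear_le {p r : ℝ} (hp : 0 ≤ p) (hr : 0 ≤ r) (hpr : 1 < p + r) :
    ∃ C : ℝ≥0∞, C ≠ ⊤ ∧ ∀ (A : ℝ) (b : ℤ), b ≠ 0 →
      ∑' k : ℤ, jap (-p) k * jap (-r) (A + 2 * b * k) ≤ C := by
  obtain ⟨C, hC, hs⟩ := exists_tsum_jap_add_le hpr
  refine ⟨C + C, by finiteness, fun A b hb => ?_⟩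
  have hb' : (b : ℝ) ≠ 0 := by exact_mod_cast hb
  have hb1 : (1 : ℝ) ≤ |(b : ℝ)| := by exact_mod_cast Int.one_le_abs hb
  calc _ ≤ ∑' k : ℤ, (jap (-(p + r)) (k + 0) + jap (-(p + r)) (k + A / (2 * b))) := by
        refine ENNReal.tsum_le_tsum fun k => ?_
        rw [add_zero]
        refine le_trans ?_ (jap_mul_jap_le_add hp hr _ _)
        gcongr
        refine jap_anti_bracket hr (bracket_mono ?_)
        have : A + 2 * b * k = (2 * b) * (k + A / (2 * b)) := by field_simp; ring
        rw [this, abs_mul]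
        refine le_mul_of_one_le_left (abs_nonneg _) ?_
        rw [abs_mul, abs_two]
        linarith
    _ ≤ _ := by
        rw [ENNReal.tsum_add]
        gcongr <;> exact hs _

/-! ### Kernel bounds on the frequency group `ℤ × ℝ` -/

/-- The Plancherel measure on the frequency space `ℤ × ℝ`. -/
def freqMeasure : Measure (ℤ × ℝ) := Measure.count.prod volume

instance : SigmaFinite freqMeasure := by unfold freqMeasure; infer_instance

instance : freqMeasure.IsAddLeftInvariant := by unfold freqMeasure; infer_instance

instance : freqMeasure.IsAddRightInvariant := by unfold freqMeasure; infer_instance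

instance : freqMeasure.IsNegInvariant where
  neg_eq_self := by
    have h := Measure.map_prod_map (Measure.count : Measure ℤ) (volume : Measure ℝ)
      measurable_neg measurable_neg
    rw [Measure.map_neg_eq_self, Measure.map_neg_eq_self] at h
    exact h.symm

/-- The modulation `τ + ξ²`. -/
def modulation (p : ℤ × ℝ) : ℝ := p.2 + (p.1 : ℝ) ^ 2

@[fun_prop]
theorem measurable_modulation : Measurable modulation := by
  unfold modulation
  fun_prop

theorem lintegral_freqMeasure {f : ℤ × ℝ → ℝ≥0∞} (hf : Measurable f) :
    ∫⁻ p, f p ∂freqMeasure = ∑' ξ : ℤ, ∫⁻ τ : ℝ, f (ξ, τ) := by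
  unfold freqMeasure
  rw [lintegral_prod _ hf.aemeasurable, lintegral_count]

/-- The counting behind the periodic `L⁴` Strichartz estimate. With the sum `s` of two frequencies
fixed, the `τ` integral leaves decay in the sum of the two modulations, which is a quadratic
polynomial in `ξ` with leading coefficient 2. -/
theorem exists_lintegral_jap_modulation_pair_le {p : ℝ} (hp : 3 / 4 < p) (hp1 : p < 1) :
    ∃ C : ℝ≥0∞, C ≠ ⊤ ∧ ∀ s : ℤ × ℝ,
      ∫⁻ q, jap (-p) (modulation q) * jap (-p) (modulation (s - q)) ∂freqMeasure ≤ C := by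
  -- `r` is the midpoint of `1/2`, needed for the sum over `ξ`, and `2p - 1`, allowed by the
  -- integral; the gap is open as `p > 3/4`.
  obtain ⟨C₁, hC₁, h₁⟩ := exists_lintegral_jap_mul_jap_le (p := p) (q := p)
    (r := (2 * p - 1 + 1 / 2) / 2) (by linarith) (by linarith) (by linarith) (by linarith)
  obtain ⟨C₂, hC₂, h₂⟩ := exists_tsum_jap_quadratic_le (r := (2 * p - 1 + 1 / 2) / 2) (by linarith)
  refine ⟨C₁ * C₂, by finiteness, fun s => ?_⟩
  rw [lintegral_freqMeasure (by fun_prop)]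
  calc _ ≤ ∑' ξ : ℤ, C₁ * jap (-((2 * p - 1 + 1 / 2) / 2))
        ((-s.2 - (s.1 : ℝ) ^ 2) * (-1) + 2 * (ξ : ℝ) ^ 2 + 2 * (-s.1 : ℤ) * ξ) := by
        refine ENNReal.tsum_le_tsum fun ξ => ?_
        have := h₁ ((ξ : ℝ) ^ 2) (-s.2 - ((s.1 : ℝ) - ξ) ^ 2)
        rw [jap_sub_comm] at this
        convert this using 3 with τ
        · congr 1
          rw [← jap_neg_arg]
          congr 1
          simp only [modulation, Prod.fst_sub, Prod.snd_sub]
          push_cast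
          ring
        · push_cast
          ring
    _ ≤ _ := by
        rw [ENNReal.tsum_mul_left]
        gcongr
        exact h₂ _ _

/-- No dispersion is needed here: one modulation weight is integrable by itself, and the frequency
weights are summable together. -/
theorem exists_lintegral_jap_pair_le {p q r : ℝ} (hp : 0 ≤ p) (hq : 0 ≤ q) (hpq : 1 < p + q)
    (hr : 1 < r) :
    ∃ C : ℝ≥0∞, C ≠ ⊤ ∧ ∀ s : ℤ × ℝ,
      ∫⁻ k : ℤ × ℝ, jap (-p) k.1 * jap (-q) ((s - k).1) * jap (-r) (modulation (s - k))
        ∂freqMeasure ≤ C := by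
  obtain ⟨C, hC, h⟩ := exists_tsum_jap_add_le hpq
  have hI := (lintegral_jap_lt_top hr).ne
  refine ⟨(C + C) * ∫⁻ x : ℝ, jap (-r) x, by finiteness, fun s => ?_⟩
  rw [lintegral_freqMeasure (by fun_prop)]
  calc _ ≤ ∑' ξ : ℤ, (jap (-(p + q)) (ξ + 0) + jap (-(p + q)) (ξ + (-s.1))) *
        ∫⁻ x : ℝ, jap (-r) x := by
        refine ENNReal.tsum_le_tsum fun ξ => ?_
        simp only [modulation, Prod.fst_sub, Prod.snd_sub]
        rw [lintegral_const_mul _ (by fun_prop)]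
        refine mul_le_mul' ?_ ?_
        · refine (jap_mul_jap_le_add hp hq _ _).trans (le_of_eq ?_)
          rw [add_zero, ← sub_eq_add_neg, Int.cast_sub, jap_sub_comm _ (s.1 : ℝ)]
        · rw [← lintegral_jap_sub_left (-r) (s.2 + ((s.1 - ξ : ℤ) : ℝ) ^ 2)]
          refine lintegral_mono fun τ => le_of_eq ?_
          congr 1
          ring
    _ ≤ _ := by
        rw [ENNReal.tsum_mul_right, ENNReal.tsum_add]
        gcongr <;> exact h _

theorem exists_lintegral_jap_triple_le {p r : ℝ} (hp1 : p < 1) (hr0 : 0 ≤ r) (hr : r < 3 * p - 2) :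
    ∃ C : ℝ≥0∞, C ≠ ⊤ ∧ ∀ a b c : ℝ,
      ∫⁻ x : ℝ, ∫⁻ y : ℝ, jap (-p) (x + a) * (jap (-p) (y + b) * jap (-p) (x + y + c)) ≤
        C * jap (-r) (c - a - b) := by
  -- The intermediate exponent must lie below `2p - 1` for the `y` integral and above `r + 1 - p`
  -- for the `x` integral. The midpoint works because `r < 3p - 2`.
  obtain ⟨C₁, hC₁, h₁⟩ := exists_lintegral_jap_mul_jap_le (p := p) (q := p)
    (r := (r + 1 - p + (2 * p - 1)) / 2) (by linarith) (by linarith) (by linarith) (by linarith)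
  obtain ⟨C₂, hC₂, h₂⟩ := exists_lintegral_jap_mul_jap_le (p := p)
    (q := (r + 1 - p + (2 * p - 1)) / 2) (r := r) hr0 (by linarith) (by linarith) (by linarith)
  refine ⟨C₁ * C₂, by finiteness, fun a b c => ?_⟩
  calc _ ≤ ∫⁻ x : ℝ, C₁ * (jap (-p) (x + a) *
        jap (-((r + 1 - p + (2 * p - 1)) / 2)) (x + (c - b))) := by
        refine lintegral_mono fun x => ?_
        rw [lintegral_const_mul _ (by fun_prop), mul_left_comm]
        gcongr
        refine (le_of_eq ?_).trans ((h₁ b (x + c)).trans (le_of_eq ?_))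
        · refine lintegral_congr fun y => ?_
          congr 2
          ring
        · congr 2
          ring
    _ ≤ _ := by
        rw [lintegral_const_mul _ (by fun_prop), mul_assoc]
        gcongr
        refine (h₂ a (c - b)).trans (le_of_eq ?_)
        congr 2
        ring

/-- Both time integrals together leave a phase quadratic in `ξ₀`, summable as soon as `3p - 2 >
1/2`. The sum over `ξ₂` then rests on `q > 1` alone. -/
theorem exists_lintegral_kernel_fst_le {p q : ℝ} (hp : 5 / 6 < p) (hp1 : p < 1) (hq : 1 < q) :
    ∃ C : ℝ≥0∞, C ≠ ⊤ ∧ ∀ p₁ : ℤ × ℝ,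
      ∫⁻ p₂ : ℤ × ℝ, ∫⁻ p₀ : ℤ × ℝ, jap (-q) p₂.1 * (jap (-p) (modulation p₂) *
        (jap (-p) (modulation p₀) * jap (-p) (modulation (p₁ + p₂ - p₀))))
        ∂freqMeasure ∂freqMeasure ≤ C := by
  obtain ⟨C₁, hC₁, h₁⟩ := exists_lintegral_jap_triple_le (p := p)
    (r := (3 * p - 2 + 1 / 2) / 2) hp1 (by linarith) (by linarith)
  obtain ⟨C₂, hC₂, h₂⟩ := exists_tsum_jap_quadratic_le (r := (3 * p - 2 + 1 / 2) / 2) (by linarith)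
  have hS := (tsum_jap_int_lt_top hq).ne
  refine ⟨(∑' n : ℤ, jap (-q) n) * (C₁ * C₂), by finiteness, fun p₁ => ?_⟩
  rw [lintegral_freqMeasure (by fun_prop), ← ENNReal.tsum_mul_right]
  refine ENNReal.tsum_le_tsum fun ξ₂ => ?_
  calc _ = jap (-q) ξ₂ * ∫⁻ τ₂ : ℝ, ∑' ξ₀ : ℤ, ∫⁻ τ₀ : ℝ,
        jap (-p) (τ₂ + (ξ₂ : ℝ) ^ 2) * (jap (-p) (τ₀ + (ξ₀ : ℝ) ^ 2) *
          jap (-p) (p₁.2 + τ₂ - τ₀ + ((p₁.1 + ξ₂ - ξ₀ : ℤ) : ℝ) ^ 2)) := by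
        rw [← lintegral_const_mul' _ _ (jap_ne_top _ _)]
        refine lintegral_congr fun τ₂ => ?_
        rw [lintegral_const_mul _ (by fun_prop), lintegral_freqMeasure (by fun_prop)]
        rfl
    _ = jap (-q) ξ₂ * ∑' ξ₀ : ℤ, ∫⁻ τ₂ : ℝ, ∫⁻ τ₀ : ℝ,
        jap (-p) (τ₂ + (ξ₂ : ℝ) ^ 2) * (jap (-p) (τ₀ + (ξ₀ : ℝ) ^ 2) *
          jap (-p) (p₁.2 + τ₂ - τ₀ + ((p₁.1 + ξ₂ - ξ₀ : ℤ) : ℝ) ^ 2)) := by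
        rw [lintegral_tsum]
        intro ξ₀
        refine Measurable.aemeasurable ?_
        exact Measurable.lintegral_prod_right' (f := fun z : ℝ × ℝ =>
          jap (-p) (z.1 + (ξ₂ : ℝ) ^ 2) * (jap (-p) (z.2 + (ξ₀ : ℝ) ^ 2) *
          jap (-p) (p₁.2 + z.1 - z.2 + ((p₁.1 + ξ₂ - ξ₀ : ℤ) : ℝ) ^ 2))) (by fun_prop)
    _ ≤ jap (-q) ξ₂ * ∑' ξ₀ : ℤ, C₁ * jap (-((3 * p - 2 + 1 / 2) / 2))
        ((p₁.2 + ((p₁.1 + ξ₂ : ℤ) : ℝ) ^ 2 - (ξ₂ : ℝ) ^ 2) + 2 * (ξ₀ : ℝ) ^ 2 +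
          2 * (-(p₁.1 + ξ₂) : ℤ) * ξ₀) := by
        gcongr with ξ₀
        have := h₁ ((ξ₂ : ℝ) ^ 2) (-(ξ₀ : ℝ) ^ 2)
          (p₁.2 + ((p₁.1 + ξ₂ - ξ₀ : ℤ) : ℝ) ^ 2)
        refine (le_of_eq ?_).trans (this.trans (le_of_eq ?_))
        · refine lintegral_congr fun τ₂ => ?_
          rw [← lintegral_neg_eq_self]
          refine lintegral_congr fun y => ?_
          congr 2
          · rw [← jap_neg_arg]
            ring_nf
          · ring_nf
        · congr 2
          push_cast
          ring
    _ ≤ _ := by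
        rw [ENNReal.tsum_mul_left]
        gcongr
        exact h₂ _ _

/-- The time integrals leave a phase equal to `2(ξ₁ - ξ₀)(ξ₂ - ξ₀)` up to a constant. The weights
`⟨ξ₁⟩⁻¹⟨ξ₂⟩⁻¹` alone diverge logarithmically in each variable. Decay is shifted so that one variable
carries the summable exponent `9/5`; in the other, `1/5` is completed by the phase, which is linear
with nonzero slope off the resonant set. Hence `r > 4/5`, that is `3p - 2 > 4/5`. -/
theorem exists_lintegral_kernel_zero_le {p : ℝ} (hp : 14 / 15 < p) (hp1 : p < 1) :
    ∃ C : ℝ≥0∞, C ≠ ⊤ ∧ ∀ p₀ : ℤ × ℝ,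
      ∫⁻ p₁ : ℤ × ℝ, ∫⁻ p₂ : ℤ × ℝ,
        (if p₀.1 ≠ p₁.1 ∧ p₀.1 ≠ p₂.1 then jap (-1) p₁.1 * jap (-1) p₂.1 else 0) *
          (jap (-p) (modulation p₁) * (jap (-p) (modulation p₂) *
            jap (-p) (modulation (p₁ + p₂ - p₀))))
        ∂freqMeasure ∂freqMeasure ≤ C := by
  obtain ⟨C₁, hC₁, h₁⟩ := exists_lintegral_jap_triple_le (p := p)
    (r := (3 * p - 2 + 4 / 5) / 2) hp1 (by linarith) (by linarith)
  obtain ⟨C₂, hC₂, h₂⟩ := exists_tsum_jap_mul_jap_linear_le (p := 1 / 5)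
    (r := (3 * p - 2 + 4 / 5) / 2) (by norm_num) (by linarith) (by linarith)
  set r := (3 * p - 2 + 4 / 5) / 2
  have hS := (tsum_jap_int_lt_top (p := 9 / 5) (by norm_num)).ne
  set S := ∑' n : ℤ, jap (-(9 / 5)) n
  refine ⟨C₁ * (S * C₂ + S * C₂), by finiteness, fun p₀ => ?_⟩
  have hm : Measurable fun z : (ℤ × ℝ) × (ℤ × ℝ) =>
      (if p₀.1 ≠ z.1.1 ∧ p₀.1 ≠ z.2.1 then jap (-1) z.1.1 * jap (-1) z.2.1 else 0) *
          (jap (-p) (modulation z.1) * (jap (-p) (modulation z.2) *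
            jap (-p) (modulation (z.1 + z.2 - p₀)))) := by
    refine Measurable.mul (Measurable.ite ?_ (by fun_prop) measurable_const) (by fun_prop)
    have : MeasurableSet {z : ℤ × ℤ | p₀.1 ≠ z.1 ∧ p₀.1 ≠ z.2} := MeasurableSet.of_discrete
    exact (show Measurable fun z : (ℤ × ℝ) × (ℤ × ℝ) => (z.1.1, z.2.1) by fun_prop) this
  rw [lintegral_freqMeasure (Measurable.lintegral_prod_right' hm)]
  have step : ∀ ξ₁ : ℤ, ∫⁻ τ₁ : ℝ, ∫⁻ p₂ : ℤ × ℝ,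
        (if p₀.1 ≠ ξ₁ ∧ p₀.1 ≠ p₂.1 then jap (-1) ξ₁ * jap (-1) p₂.1 else 0) *
          (jap (-p) (modulation (ξ₁, τ₁)) * (jap (-p) (modulation p₂) *
            jap (-p) (modulation ((ξ₁, τ₁) + p₂ - p₀)))) ∂freqMeasure ≤
      C₁ * ∑' ξ₂ : ℤ, ((if p₀.1 ≠ ξ₁ then jap (-(9 / 5)) ξ₁ * (jap (-(1 / 5)) ξ₂ * jap (-r)
          ((-p₀.2 - (p₀.1 : ℝ) ^ 2 - 2 * p₀.1 * ((ξ₁ - p₀.1 : ℤ) : ℝ)) +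
            2 * (ξ₁ - p₀.1 : ℤ) * ξ₂)) else 0) +
        if p₀.1 ≠ ξ₂ then jap (-(9 / 5)) ξ₂ * (jap (-(1 / 5)) ξ₁ * jap (-r)
          ((-p₀.2 - (p₀.1 : ℝ) ^ 2 - 2 * p₀.1 * ((ξ₂ - p₀.1 : ℤ) : ℝ)) +
            2 * (ξ₂ - p₀.1 : ℤ) * ξ₁)) else 0) := by
    intro ξ₁
    calc _ = ∑' ξ₂ : ℤ, ∫⁻ τ₁ : ℝ, ∫⁻ τ₂ : ℝ,
        (if p₀.1 ≠ ξ₁ ∧ p₀.1 ≠ ξ₂ then jap (-1) ξ₁ * jap (-1) ξ₂ else 0) *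
          (jap (-p) (τ₁ + (ξ₁ : ℝ) ^ 2) * (jap (-p) (τ₂ + (ξ₂ : ℝ) ^ 2) *
            jap (-p) (τ₁ + τ₂ + (-p₀.2 + ((ξ₁ + ξ₂ - p₀.1 : ℤ) : ℝ) ^ 2)))) := by
          rw [← lintegral_tsum]
          · refine lintegral_congr fun τ₁ => ?_
            refine (lintegral_freqMeasure
              (hm.comp (measurable_prodMk_left (x := ((ξ₁, τ₁) : ℤ × ℝ))))).trans ?_
            refine tsum_congr fun ξ₂ => lintegral_congr fun τ₂ => ?_
            simp only [modulation, Prod.fst_add, Prod.fst_sub, Prod.snd_add, Prod.snd_sub,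
              Function.comp_apply]
            congr 4
            ring
          · intro ξ₂
            refine Measurable.aemeasurable ?_
            exact Measurable.lintegral_prod_right' (f := fun z : ℝ × ℝ =>
              (if p₀.1 ≠ ξ₁ ∧ p₀.1 ≠ ξ₂ then jap (-1) ξ₁ * jap (-1) ξ₂ else 0) *
              (jap (-p) (z.1 + (ξ₁ : ℝ) ^ 2) * (jap (-p) (z.2 + (ξ₂ : ℝ) ^ 2) *
                jap (-p) (z.1 + z.2 + (-p₀.2 + ((ξ₁ + ξ₂ - p₀.1 : ℤ) : ℝ) ^ 2)))))
              (by fun_prop)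
      _ ≤ ∑' ξ₂ : ℤ, C₁ * ((if p₀.1 ≠ ξ₁ ∧ p₀.1 ≠ ξ₂ then jap (-1) ξ₁ * jap (-1) ξ₂ else 0) *
          jap (-r) (-p₀.2 - (p₀.1 : ℝ) ^ 2 + 2 * ((ξ₁ : ℝ) - p₀.1) * (ξ₂ - p₀.1))) := by
          refine ENNReal.tsum_le_tsum fun ξ₂ => ?_
          have := h₁ ((ξ₁ : ℝ) ^ 2) ((ξ₂ : ℝ) ^ 2) (-p₀.2 + ((ξ₁ + ξ₂ - p₀.1 : ℤ) : ℝ) ^ 2)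
          have hK : (if p₀.1 ≠ ξ₁ ∧ p₀.1 ≠ ξ₂ then jap (-1) ξ₁ * jap (-1) ξ₂ else 0) ≠ ⊤ := by
            split_ifs
            · exact ENNReal.mul_ne_top (jap_ne_top _ _) (jap_ne_top _ _)
            · exact ENNReal.zero_ne_top
          simp_rw [lintegral_const_mul' _ _ hK]
          rw [mul_left_comm]
          gcongr
          refine this.trans (le_of_eq ?_)
          congr 2
          push_cast
          ring
      _ ≤ _ := by
          rw [← ENNReal.tsum_mul_left]
          refine ENNReal.tsum_le_tsum fun ξ₂ => ?_
          gcongr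
          by_cases hc : p₀.1 ≠ ξ₁ ∧ p₀.1 ≠ ξ₂
          · rw [if_pos hc, if_pos hc.1, if_pos hc.2]
            have hy := jap_mul_jap_le (p := 1) (q := 1) (p' := 9 / 5) (q' := 1 / 5) (by norm_num)
              (by norm_num) (by norm_num) ξ₁ ξ₂
            refine (mul_le_mul_left hy _).trans (le_of_eq ?_)
            rw [add_mul, mul_assoc, mul_right_comm, mul_assoc, mul_comm (jap (-(9/5)) (ξ₂ : ℝ))]
            push_cast
            ring_nf
          · rw [if_neg hc, zero_mul]
            exact zero_le
  refine (ENNReal.tsum_le_tsum step).trans ?_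
  rw [ENNReal.tsum_mul_left]
  gcongr
  simp_rw [ENNReal.tsum_add]
  -- One bound serves both halves of the split, which differ by exchanging `ξ₁` and `ξ₂`.
  have final : ∀ a : ℤ, ∑' b : ℤ, (if p₀.1 ≠ a then jap (-(9 / 5)) a * (jap (-(1 / 5)) b * jap (-r)
      ((-p₀.2 - (p₀.1 : ℝ) ^ 2 - 2 * p₀.1 * ((a - p₀.1 : ℤ) : ℝ)) +
            2 * (a - p₀.1 : ℤ) * b)) else 0) ≤ jap (-(9 / 5)) a * C₂ := by
    intro a
    by_cases ha : p₀.1 ≠ a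
    · simp only [if_pos ha]
      rw [ENNReal.tsum_mul_left]
      gcongr
      exact h₂ _ _ (sub_ne_zero.2 ha.symm)
    · simp [if_neg ha]
  gcongr
  · exact (ENNReal.tsum_le_tsum final).trans (ENNReal.tsum_mul_right).le
  · rw [ENNReal.tsum_comm]
    exact (ENNReal.tsum_le_tsum final).trans (ENNReal.tsum_mul_right).le

/-! ### Cauchy–Schwarz estimates for the quadrilinear form -/

theorem sq_lintegral_mul_le {α : Type*} [MeasurableSpace α] (μ : Measure α) {f g : α → ℝ≥0∞}
    (hf : AEMeasurable f μ) (hg : AEMeasurable g μ) :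
    (∫⁻ x, f x * g x ∂μ) ^ 2 ≤ (∫⁻ x, f x ^ 2 ∂μ) * ∫⁻ x, g x ^ 2 ∂μ := by
  have h := ENNReal.lintegral_mul_le_Lp_mul_Lq μ Real.HolderConjugate.two_two hf hg
  simp only [ENNReal.rpow_two, Pi.mul_apply] at h
  calc _ ≤ _ := pow_le_pow_left' h 2
    _ = _ := by
      rw [mul_pow, ← ENNReal.rpow_two, ← ENNReal.rpow_two, ← ENNReal.rpow_mul, ← ENNReal.rpow_mul]
      norm_num

/-- Cauchy–Schwarz in the inner variable against a kernel with uniformly bounded inner norm. -/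
theorem sq_lintegral_kernel_le {α β : Type*} [MeasurableSpace α] [MeasurableSpace β]
    (μ : Measure α) (ν : Measure β) [SFinite ν] {f : α → ℝ≥0∞} {g K : α → β → ℝ≥0∞}
    (hf : Measurable f) (hg : Measurable (Function.uncurry g))
    (hK : Measurable (Function.uncurry K)) {C : ℝ≥0∞} (hC : ∀ x, ∫⁻ y, K x y ^ 2 ∂ν ≤ C) :
    (∫⁻ x, f x * ∫⁻ y, g x y * K x y ∂ν ∂μ) ^ 2 ≤
      C * (∫⁻ x, f x ^ 2 ∂μ) * ∫⁻ x, ∫⁻ y, g x y ^ 2 ∂ν ∂μ := by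
  have hgK : Measurable fun x => ∫⁻ y, g x y * K x y ∂ν :=
    Measurable.lintegral_prod_right' (hg.mul hK)
  calc _ ≤ (∫⁻ x, f x ^ 2 ∂μ) * ∫⁻ x, (∫⁻ y, g x y * K x y ∂ν) ^ 2 ∂μ :=
        sq_lintegral_mul_le μ hf.aemeasurable hgK.aemeasurable
    _ ≤ (∫⁻ x, f x ^ 2 ∂μ) * ∫⁻ x, (∫⁻ y, g x y ^ 2 ∂ν) * C ∂μ := by
        gcongr with x
        refine (sq_lintegral_mul_le ν (hg.of_uncurry_left).aemeasurable
          (hK.of_uncurry_left).aemeasurable).trans ?_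
        gcongr
        exact hC x
    _ = _ := by
        have hg2 : Measurable fun x => ∫⁻ y, g x y ^ 2 ∂ν :=
          Measurable.lintegral_prod_right' (hg.pow_const 2)
        rw [lintegral_mul_const _ hg2]
        ring

/-- The squared `L²` norm on the frequency space. -/
def sqNorm (f : ℤ × ℝ → ℝ≥0∞) : ℝ≥0∞ := ∫⁻ p, f p ^ 2 ∂freqMeasure

/-- The quadrilinear form with kernel `K` over the frequencies `p₀ + p₃ = p₁ + p₂`. -/
def quadForm (f₀ f₁ f₂ f₃ : ℤ × ℝ → ℝ≥0∞) (K : ℤ × ℝ → ℤ × ℝ → ℤ × ℝ → ℝ≥0∞) : ℝ≥0∞ :=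
  ∫⁻ p₀, ∫⁻ p₁, ∫⁻ p₂, f₀ p₀ * (f₁ p₁ * (f₂ p₂ * f₃ (p₁ + p₂ - p₀))) * K p₀ p₁ p₂
    ∂freqMeasure ∂freqMeasure ∂freqMeasure

/-- Joint measurability of a kernel of three frequencies. -/
def MeasurableKernel (K : ℤ × ℝ → ℤ × ℝ → ℤ × ℝ → ℝ≥0∞) : Prop :=
  Measurable fun z : (ℤ × ℝ) × (ℤ × ℝ) × (ℤ × ℝ) => K z.1 z.2.1 z.2.2

section

variable {f₀ f₁ f₂ f₃ : ℤ × ℝ → ℝ≥0∞} {K : ℤ × ℝ → ℤ × ℝ → ℤ × ℝ → ℝ≥0∞}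

theorem MeasurableKernel.comp {α : Type*} [MeasurableSpace α] (hK : MeasurableKernel K)
    {a b c : α → ℤ × ℝ} (ha : Measurable a) (hb : Measurable b) (hc : Measurable c) :
    Measurable fun z => K (a z) (b z) (c z) :=
  Measurable.comp (g := fun z : (ℤ × ℝ) × (ℤ × ℝ) × (ℤ × ℝ) => K z.1 z.2.1 z.2.2) hK
    (ha.prodMk (hb.prodMk hc))

theorem quadForm_mono {K' : ℤ × ℝ → ℤ × ℝ → ℤ × ℝ → ℝ≥0∞}
    (h : ∀ p₀ p₁ p₂, K p₀ p₁ p₂ ≤ K' p₀ p₁ p₂) :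
    quadForm f₀ f₁ f₂ f₃ K ≤ quadForm f₀ f₁ f₂ f₃ K' := by
  unfold quadForm
  gcongr
  exact h _ _ _

/-- Moving the variable `p₀` to the innermost position. -/
theorem quadForm_eq_lintegral_zero_inner (h₀ : Measurable f₀) (h₁ : Measurable f₁)
    (h₂ : Measurable f₂) (h₃ : Measurable f₃) (hK : MeasurableKernel K) :
    quadForm f₀ f₁ f₂ f₃ K = ∫⁻ p₁, ∫⁻ p₂, ∫⁻ p₀,
      f₀ p₀ * (f₁ p₁ * (f₂ p₂ * f₃ (p₁ + p₂ - p₀))) * K p₀ p₁ p₂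
        ∂freqMeasure ∂freqMeasure ∂freqMeasure := by
  unfold quadForm
  rw [lintegral_lintegral_swap]
  · refine lintegral_congr fun p₁ => ?_
    rw [lintegral_lintegral_swap]
    refine Measurable.aemeasurable ?_
    exact Measurable.mul (by fun_prop) (hK.comp (by fun_prop) (by fun_prop) (by fun_prop))
  · refine Measurable.aemeasurable ?_
    refine Measurable.lintegral_prod_right' (f := fun z : ((ℤ × ℝ) × (ℤ × ℝ)) × (ℤ × ℝ) =>
      f₀ z.1.1 * (f₁ z.1.2 * (f₂ z.2 * f₃ (z.1.2 + z.2 - z.1.1))) * K z.1.1 z.1.2 z.2) ?_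
    exact Measurable.mul (by fun_prop) (hK.comp (by fun_prop) (by fun_prop) (by fun_prop))

theorem quadForm_swap_one_two (h₁ : Measurable f₁)
    (h₂ : Measurable f₂) (h₃ : Measurable f₃) (hK : MeasurableKernel K) :
    quadForm f₀ f₁ f₂ f₃ K = quadForm f₀ f₂ f₁ f₃ (fun p₀ p₁ p₂ => K p₀ p₂ p₁) := by
  unfold quadForm
  refine lintegral_congr fun p₀ => ?_
  rw [lintegral_lintegral_swap]
  · refine lintegral_congr fun p₁ => lintegral_congr fun p₂ => ?_
    rw [add_comm p₂ p₁]
    ring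
  · refine Measurable.aemeasurable ?_
    exact Measurable.mul (by fun_prop) (hK.comp (by fun_prop) (by fun_prop) (by fun_prop))

/-- The reflection `p₀ ↦ p₁ + p₂ - p₀` preserves the measure. It reduces a dominant `σ₃` to a
dominant `σ₀`. -/
theorem quadForm_swap_zero_three (h₀ : Measurable f₀) (h₁ : Measurable f₁)
    (h₂ : Measurable f₂) (h₃ : Measurable f₃) (hK : MeasurableKernel K) :
    quadForm f₀ f₁ f₂ f₃ K =
      quadForm f₃ f₁ f₂ f₀ (fun p₀ p₁ p₂ => K (p₁ + p₂ - p₀) p₁ p₂) := by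
  have hK' : MeasurableKernel fun p₀ p₁ p₂ => K (p₁ + p₂ - p₀) p₁ p₂ :=
    hK.comp (by fun_prop) (by fun_prop) (by fun_prop)
  rw [quadForm_eq_lintegral_zero_inner h₀ h₁ h₂ h₃ hK,
    quadForm_eq_lintegral_zero_inner h₃ h₁ h₂ h₀ hK']
  refine lintegral_congr fun p₁ => lintegral_congr fun p₂ => ?_
  rw [← lintegral_sub_left_eq_self _ (p₁ + p₂)]
  refine lintegral_congr fun p₀ => ?_
  rw [sub_sub_cancel]
  ring

theorem lintegral_three_sq (h₁ : Measurable f₁) (h₂ : Measurable f₂) (h₃ : Measurable f₃) :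
    ∫⁻ p₀, ∫⁻ z : (ℤ × ℝ) × (ℤ × ℝ), (f₁ z.1 * (f₂ z.2 * f₃ (z.1 + z.2 - p₀))) ^ 2
      ∂(freqMeasure.prod freqMeasure) ∂freqMeasure = sqNorm f₁ * sqNorm f₂ * sqNorm f₃ := by
  rw [lintegral_lintegral_swap (by exact Measurable.aemeasurable (by fun_prop))]
  have e : ∀ z : (ℤ × ℝ) × (ℤ × ℝ), ∫⁻ p₀, (f₁ z.1 * (f₂ z.2 * f₃ (z.1 + z.2 - p₀))) ^ 2
      ∂freqMeasure = f₁ z.1 ^ 2 * f₂ z.2 ^ 2 * sqNorm f₃ := by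
    intro z
    simp_rw [mul_pow, ← mul_assoc]
    rw [lintegral_const_mul _ (by fun_prop),
      lintegral_sub_left_eq_self (fun p => f₃ p ^ 2) (z.1 + z.2)]
    rfl
  simp_rw [e]
  rw [lintegral_mul_const _ (by fun_prop),
    lintegral_prod_mul (h₁.pow_const 2).aemeasurable (h₂.pow_const 2).aemeasurable]
  rfl

/-- Cauchy–Schwarz in `(p₁, p₂)` against the kernel, then in `p₀`. By translation invariance the
`L²` norm of the product of the other three functions factors. -/
theorem sq_quadForm_le_of_zero_outer (h₀ : Measurable f₀) (h₁ : Measurable f₁)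
    (h₂ : Measurable f₂) (h₃ : Measurable f₃) (hK : MeasurableKernel K) {C : ℝ≥0∞}
    (hC : ∀ p₀, ∫⁻ p₁, ∫⁻ p₂, K p₀ p₁ p₂ ^ 2 ∂freqMeasure ∂freqMeasure ≤ C) :
    quadForm f₀ f₁ f₂ f₃ K ^ 2 ≤ C * (sqNorm f₀ * (sqNorm f₁ * sqNorm f₂ * sqNorm f₃)) := by
  have key := sq_lintegral_kernel_le freqMeasure (freqMeasure.prod freqMeasure) (f := f₀)
    (g := fun p₀ z => f₁ z.1 * (f₂ z.2 * f₃ (z.1 + z.2 - p₀))) (K := fun p₀ z => K p₀ z.1 z.2)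
    h₀ (by fun_prop) hK (C := C) (fun p₀ => by
      rw [lintegral_prod _ (Measurable.aemeasurable
        ((hK.comp (by fun_prop) (by fun_prop) (by fun_prop)).pow_const 2))]
      exact hC p₀)
  rw [lintegral_three_sq h₁ h₂ h₃, mul_assoc] at key
  refine le_trans (le_of_eq ?_) key
  congr 1
  refine lintegral_congr fun p₀ => ?_
  have hm : Measurable fun z : (ℤ × ℝ) × (ℤ × ℝ) =>
      f₁ z.1 * (f₂ z.2 * f₃ (z.1 + z.2 - p₀)) * K p₀ z.1 z.2 :=
    Measurable.mul (by fun_prop) (hK.comp (by fun_prop) (by fun_prop) (by fun_prop))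
  rw [lintegral_prod _ hm.aemeasurable, ← lintegral_const_mul _ hm.lintegral_prod_right']
  refine lintegral_congr fun p₁ => ?_
  refine Eq.trans ?_ (lintegral_const_mul _ (hm.comp measurable_prodMk_left))
  refine lintegral_congr fun p₂ => ?_
  simp only
  ring

theorem sq_quadForm_le_of_one_outer (h₀ : Measurable f₀) (h₁ : Measurable f₁)
    (h₂ : Measurable f₂) (h₃ : Measurable f₃) (hK : MeasurableKernel K) {C : ℝ≥0∞}
    (hC : ∀ p₁, ∫⁻ p₂, ∫⁻ p₀, K p₀ p₁ p₂ ^ 2 ∂freqMeasure ∂freqMeasure ≤ C) :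
    quadForm f₀ f₁ f₂ f₃ K ^ 2 ≤ C * (sqNorm f₀ * (sqNorm f₁ * sqNorm f₂ * sqNorm f₃)) := by
  have key := sq_lintegral_kernel_le freqMeasure (freqMeasure.prod freqMeasure) (f := f₁)
    (g := fun p₁ z => f₂ z.1 * (f₀ z.2 * f₃ (p₁ + z.1 - z.2))) (K := fun p₁ z => K z.2 p₁ z.1)
    h₁ (by fun_prop) (hK.comp (by fun_prop) (by fun_prop) (by fun_prop)) (C := C) (fun p₁ => by
      rw [lintegral_prod _ (Measurable.aemeasurable
        ((hK.comp (by fun_prop) (by fun_prop) (by fun_prop)).pow_const 2))]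
      exact hC p₁)
  have e3 : ∫⁻ p₁, ∫⁻ z : (ℤ × ℝ) × (ℤ × ℝ), (f₂ z.1 * (f₀ z.2 * f₃ (p₁ + z.1 - z.2))) ^ 2
      ∂(freqMeasure.prod freqMeasure) ∂freqMeasure = sqNorm f₂ * sqNorm f₀ * sqNorm f₃ := by
    rw [lintegral_lintegral_swap (by exact Measurable.aemeasurable (by fun_prop))]
    have e : ∀ z : (ℤ × ℝ) × (ℤ × ℝ), ∫⁻ p₁, (f₂ z.1 * (f₀ z.2 * f₃ (p₁ + z.1 - z.2))) ^ 2
        ∂freqMeasure = f₂ z.1 ^ 2 * f₀ z.2 ^ 2 * sqNorm f₃ := by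
      intro z
      simp_rw [mul_pow, ← mul_assoc, add_sub_assoc]
      rw [lintegral_const_mul _ (by fun_prop),
        lintegral_add_right_eq_self (fun p => f₃ p ^ 2) (z.1 - z.2)]
      rfl
    simp_rw [e]
    rw [lintegral_mul_const _ (by fun_prop),
      lintegral_prod_mul (h₂.pow_const 2).aemeasurable (h₀.pow_const 2).aemeasurable]
    rfl
  rw [e3] at key
  refine le_trans (le_of_eq ?_) (key.trans (le_of_eq (by unfold sqNorm; ring)))
  rw [quadForm_eq_lintegral_zero_inner h₀ h₁ h₂ h₃ hK]
  congr 1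
  refine lintegral_congr fun p₁ => ?_
  have hm : Measurable fun z : (ℤ × ℝ) × (ℤ × ℝ) =>
      f₂ z.1 * (f₀ z.2 * f₃ (p₁ + z.1 - z.2)) * K z.2 p₁ z.1 :=
    Measurable.mul (by fun_prop) (hK.comp (by fun_prop) (by fun_prop) (by fun_prop))
  rw [lintegral_prod _ hm.aemeasurable, ← lintegral_const_mul _ hm.lintegral_prod_right']
  refine lintegral_congr fun p₂ => ?_
  refine Eq.trans ?_ (lintegral_const_mul _ (hm.comp measurable_prodMk_left))
  refine lintegral_congr fun p₀ => ?_
  simp only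
  ring

/-- Bilinear `L² × L² → L²` bound: Cauchy–Schwarz on each fibre of constant sum `s`, then Tonelli.
-/
theorem lintegral_sq_convolution_le {f g : ℤ × ℝ → ℝ≥0∞} {k : ℤ × ℝ → ℤ × ℝ → ℝ≥0∞}
    (hf : Measurable f) (hg : Measurable g) (hk : Measurable (Function.uncurry k)) {C : ℝ≥0∞}
    (hC : ∀ s, ∫⁻ p, k p (s - p) ^ 2 ∂freqMeasure ≤ C) :
    ∫⁻ s, (∫⁻ p, f p * g (s - p) * k p (s - p) ∂freqMeasure) ^ 2 ∂freqMeasure ≤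
      C * (sqNorm f * sqNorm g) := by
  calc _ ≤ ∫⁻ s, (∫⁻ p, (f p * g (s - p)) ^ 2 ∂freqMeasure) * C ∂freqMeasure := by
        gcongr with s
        refine (sq_lintegral_mul_le freqMeasure (f := fun p => f p * g (s - p))
          (Measurable.aemeasurable (by fun_prop))
          (hk.comp (f := fun p => (p, s - p)) (by fun_prop)).aemeasurable).trans ?_
        gcongr
        exact hC s
    _ = (∫⁻ p, ∫⁻ s, (f p * g (s - p)) ^ 2 ∂freqMeasure ∂freqMeasure) * C := by
        rw [lintegral_mul_const _ (Measurable.lintegral_prod_right'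
          (f := fun z : (ℤ × ℝ) × (ℤ × ℝ) => (f z.2 * g (z.1 - z.2)) ^ 2) (by fun_prop)),
          lintegral_lintegral_swap (by exact Measurable.aemeasurable (by fun_prop))]
    _ = _ := by
        have e : ∀ p, ∫⁻ s, (f p * g (s - p)) ^ 2 ∂freqMeasure = f p ^ 2 * sqNorm g := by
          intro p
          simp_rw [mul_pow]
          rw [lintegral_const_mul _ (by fun_prop),
            lintegral_sub_right_eq_self (fun p => g p ^ 2) p]
          rfl
        simp_rw [e]
        rw [lintegral_mul_const _ (by fun_prop), mul_comm]
        rfl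

/-- In the variable `s = p₁ + p₂ = p₀ + p₃` the form is the inner product of two weighted
convolutions, each bounded in `L²`. -/
theorem sq_quadForm_le_of_pairs {k l : ℤ × ℝ → ℤ × ℝ → ℝ≥0∞} (h₀ : Measurable f₀)
    (h₁ : Measurable f₁) (h₂ : Measurable f₂) (h₃ : Measurable f₃)
    (hk : Measurable (Function.uncurry k)) (hl : Measurable (Function.uncurry l)) {C D : ℝ≥0∞}
    (hC : ∀ s, ∫⁻ p, k p (s - p) ^ 2 ∂freqMeasure ≤ C)
    (hD : ∀ s, ∫⁻ p, l p (s - p) ^ 2 ∂freqMeasure ≤ D) :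
    quadForm f₀ f₁ f₂ f₃ (fun p₀ p₁ p₂ => k p₀ (p₁ + p₂ - p₀) * l p₁ p₂) ^ 2 ≤
      C * D * (sqNorm f₀ * (sqNorm f₁ * sqNorm f₂ * sqNorm f₃)) := by
  have hk' : ∀ {α : Type} [MeasurableSpace α] {a b : α → ℤ × ℝ}, Measurable a → Measurable b →
      Measurable fun z => k (a z) (b z) := fun ha hb => hk.comp (ha.prodMk hb)
  have hl' : ∀ {α : Type} [MeasurableSpace α] {a b : α → ℤ × ℝ}, Measurable a → Measurable b →
      Measurable fun z => l (a z) (b z) := fun ha hb => hl.comp (ha.prodMk hb)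
  have hmB : Measurable fun z : (ℤ × ℝ) × (ℤ × ℝ) =>
      f₀ z.2 * f₃ (z.1 - z.2) * k z.2 (z.1 - z.2) :=
    Measurable.mul (by fun_prop) (hk' (by fun_prop) (by fun_prop))
  have hmA : Measurable fun z : (ℤ × ℝ) × (ℤ × ℝ) =>
      f₁ z.2 * f₂ (z.1 - z.2) * l z.2 (z.1 - z.2) :=
    Measurable.mul (by fun_prop) (hl' (by fun_prop) (by fun_prop))
  set B : ℤ × ℝ → ℝ≥0∞ := fun s => ∫⁻ p, f₀ p * f₃ (s - p) * k p (s - p) ∂freqMeasure with hB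
  set A : ℤ × ℝ → ℝ≥0∞ := fun s => ∫⁻ p, f₁ p * f₂ (s - p) * l p (s - p) ∂freqMeasure with hA
  have hBm : Measurable B := hmB.lintegral_prod_right'
  have hAm : Measurable A := hmA.lintegral_prod_right'
  have e : quadForm f₀ f₁ f₂ f₃ (fun p₀ p₁ p₂ => k p₀ (p₁ + p₂ - p₀) * l p₁ p₂) =
      ∫⁻ s, A s * B s ∂freqMeasure := by
    have hK : MeasurableKernel fun p₀ p₁ p₂ => k p₀ (p₁ + p₂ - p₀) * l p₁ p₂ := by
      unfold MeasurableKernel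
      exact (hk' (by fun_prop) (by fun_prop)).mul (hl' (by fun_prop) (by fun_prop))
    rw [quadForm_eq_lintegral_zero_inner h₀ h₁ h₂ h₃ hK]
    calc _ = ∫⁻ p₁, ∫⁻ p₂, f₁ p₁ * f₂ p₂ * l p₁ p₂ * B (p₁ + p₂) ∂freqMeasure ∂freqMeasure := by
          refine lintegral_congr fun p₁ => lintegral_congr fun p₂ => ?_
          refine Eq.trans ?_ (lintegral_const_mul _ (hmB.comp measurable_prodMk_left))
          refine lintegral_congr fun p₀ => ?_
          ring
      _ = ∫⁻ p₁, ∫⁻ s, f₁ p₁ * f₂ (s - p₁) * l p₁ (s - p₁) * B s ∂freqMeasure ∂freqMeasure := by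
          refine lintegral_congr fun p₁ => ?_
          rw [← lintegral_sub_right_eq_self _ p₁]
          simp only [add_sub_cancel]
      _ = _ := by
          rw [lintegral_lintegral_swap]
          · refine lintegral_congr fun s => ?_
            exact lintegral_mul_const _ (hmA.comp measurable_prodMk_left)
          · refine Measurable.aemeasurable ?_
            exact Measurable.mul (hmA.comp measurable_swap) (hBm.comp measurable_snd)
  rw [e]
  refine (sq_lintegral_mul_le _ hAm.aemeasurable hBm.aemeasurable).trans ?_
  calc _ ≤ D * (sqNorm f₁ * sqNorm f₂) * (C * (sqNorm f₀ * sqNorm f₃)) := by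
        gcongr
        · exact lintegral_sq_convolution_le h₁ h₂ hl hD
        · exact lintegral_sq_convolution_le h₀ h₃ hk hC
    _ = _ := by ring

end

/-! ### Bounded kernels -/

/-- A kernel whose quadrilinear form is bounded on `L²`. -/
structure BoundedKernel (K : ℤ × ℝ → ℤ × ℝ → ℤ × ℝ → ℝ≥0∞) : Prop where
  measurable : MeasurableKernel K
  bound : ∃ C : ℝ≥0∞, C ≠ ⊤ ∧ ∀ f₀ f₁ f₂ f₃ : ℤ × ℝ → ℝ≥0∞, Measurable f₀ → Measurable f₁ →
    Measurable f₂ → Measurable f₃ →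
    quadForm f₀ f₁ f₂ f₃ K ^ 2 ≤ C * (sqNorm f₀ * (sqNorm f₁ * sqNorm f₂ * sqNorm f₃))

theorem add_sq_le_two_mul_sq_add_sq (a b : ℝ≥0∞) : (a + b) ^ 2 ≤ 2 * (a ^ 2 + b ^ 2) := by
  have := ENNReal.rpow_add_le_mul_rpow_add_rpow a b (p := 2) one_le_two
  norm_num at this
  exact this

section

variable {K L : ℤ × ℝ → ℤ × ℝ → ℤ × ℝ → ℝ≥0∞}

theorem BoundedKernel.mono (hK : MeasurableKernel K) (hL : BoundedKernel L)
    (h : ∀ p₀ p₁ p₂, K p₀ p₁ p₂ ≤ L p₀ p₁ p₂) : BoundedKernel K := by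
  obtain ⟨C, hC, hb⟩ := hL.bound
  refine ⟨hK, C, hC, fun f₀ f₁ f₂ f₃ h₀ h₁ h₂ h₃ => ?_⟩
  exact (pow_le_pow_left' (quadForm_mono h) 2).trans (hb _ _ _ _ h₀ h₁ h₂ h₃)

theorem quadForm_add {f₀ f₁ f₂ f₃ : ℤ × ℝ → ℝ≥0∞} (h₀ : Measurable f₀) (h₁ : Measurable f₁)
    (h₂ : Measurable f₂) (h₃ : Measurable f₃) (hK : MeasurableKernel K) :
    quadForm f₀ f₁ f₂ f₃ (fun p₀ p₁ p₂ => K p₀ p₁ p₂ + L p₀ p₁ p₂) =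
      quadForm f₀ f₁ f₂ f₃ K + quadForm f₀ f₁ f₂ f₃ L := by
  have hm : Measurable fun z : ((ℤ × ℝ) × (ℤ × ℝ)) × (ℤ × ℝ) =>
      f₀ z.1.1 * (f₁ z.1.2 * (f₂ z.2 * f₃ (z.1.2 + z.2 - z.1.1))) * K z.1.1 z.1.2 z.2 :=
    Measurable.mul (by fun_prop) (hK.comp (by fun_prop) (by fun_prop) (by fun_prop))
  have hm2 := hm.lintegral_prod_right' (ν := freqMeasure)
  have hm3 := hm2.lintegral_prod_right' (ν := freqMeasure)
  unfold quadForm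
  refine Eq.trans ?_ (lintegral_add_left hm3 _)
  refine lintegral_congr fun p₀ => ?_
  refine Eq.trans ?_ (lintegral_add_left (hm2.comp measurable_prodMk_left) _)
  refine lintegral_congr fun p₁ => ?_
  refine Eq.trans ?_ (lintegral_add_left (hm.comp measurable_prodMk_left) _)
  refine lintegral_congr fun p₂ => ?_
  simp only [Function.comp_apply]
  ring

theorem BoundedKernel.add (hK : BoundedKernel K) (hL : BoundedKernel L) :
    BoundedKernel fun p₀ p₁ p₂ => K p₀ p₁ p₂ + L p₀ p₁ p₂ := by
  obtain ⟨C, hC, hb⟩ := hK.bound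
  obtain ⟨D, hD, hd⟩ := hL.bound
  refine ⟨Measurable.add hK.measurable hL.measurable, 2 * (C + D), by finiteness,
    fun f₀ f₁ f₂ f₃ h₀ h₁ h₂ h₃ => ?_⟩
  rw [quadForm_add h₀ h₁ h₂ h₃ hK.measurable]
  refine (add_sq_le_two_mul_sq_add_sq _ _).trans ?_
  rw [mul_assoc, add_mul]
  gcongr
  · exact hb _ _ _ _ h₀ h₁ h₂ h₃
  · exact hd _ _ _ _ h₀ h₁ h₂ h₃

theorem BoundedKernel.swap_one_two (hK : BoundedKernel K) :
    BoundedKernel fun p₀ p₁ p₂ => K p₀ p₂ p₁ := by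
  have hK' : MeasurableKernel fun p₀ p₁ p₂ => K p₀ p₂ p₁ :=
    hK.measurable.comp (by fun_prop) (by fun_prop) (by fun_prop)
  obtain ⟨C, hC, hb⟩ := hK.bound
  refine ⟨hK', C, hC, fun f₀ f₁ f₂ f₃ h₀ h₁ h₂ h₃ => ?_⟩
  rw [quadForm_swap_one_two h₁ h₂ h₃ hK']
  refine (hb _ _ _ _ h₀ h₂ h₁ h₃).trans (le_of_eq (by ring))

theorem BoundedKernel.swap_zero_three (hK : BoundedKernel K) :
    BoundedKernel fun p₀ p₁ p₂ => K (p₁ + p₂ - p₀) p₁ p₂ := by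
  have hK' : MeasurableKernel fun p₀ p₁ p₂ => K (p₁ + p₂ - p₀) p₁ p₂ :=
    hK.measurable.comp (by fun_prop) (by fun_prop) (by fun_prop)
  obtain ⟨C, hC, hb⟩ := hK.bound
  refine ⟨hK', C, hC, fun f₀ f₁ f₂ f₃ h₀ h₁ h₂ h₃ => ?_⟩
  rw [quadForm_swap_zero_three h₀ h₁ h₂ h₃ hK']
  simp only [sub_sub_cancel]
  refine (hb _ _ _ _ h₃ h₁ h₂ h₀).trans (le_of_eq (by ring))

end

/-- The kernel controlling the contribution without derivative gain. -/
def kernelUnit (p₀ p₁ p₂ : ℤ × ℝ) : ℝ≥0∞ :=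
  jap (-(49 / 100)) (modulation p₀) * jap (-(49 / 100)) (modulation (p₁ + p₂ - p₀)) *
    (jap (-(49 / 100)) (modulation p₁) * jap (-(49 / 100)) (modulation p₂))

/-- The kernel for a dominant modulation of the frequency `p₀`. -/
def kernelZero (p₀ p₁ p₂ : ℤ × ℝ) : ℝ≥0∞ :=
  (if p₀.1 ≠ p₁.1 ∧ p₀.1 ≠ p₂.1 then jap (-(1 / 2)) p₁.1 * jap (-(1 / 2)) p₂.1 else 0) *
    (jap (-(49 / 100)) (modulation p₁) * (jap (-(49 / 100)) (modulation p₂) *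
      jap (-(49 / 100)) (modulation (p₁ + p₂ - p₀))))

/-- The kernel for a dominant modulation of the frequency `p₁`. -/
def kernelOne (p₀ p₁ p₂ : ℤ × ℝ) : ℝ≥0∞ :=
  jap (-(1 / 2)) p₁.1 * jap (-(1 / 2)) p₂.1 *
    (jap (-(49 / 100)) (modulation p₂) * (jap (-(49 / 100)) (modulation p₀) *
      jap (-(49 / 100)) (modulation (p₁ + p₂ - p₀))))

/-! ### Boundedness of the model kernels -/

theorem boundedKernel_kernelUnit : BoundedKernel kernelUnit := by
  obtain ⟨C, hC, h⟩ := exists_lintegral_jap_modulation_pair_le (p := 2 * (49 / 100))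
    (by norm_num) (by norm_num)
  refine ⟨by unfold MeasurableKernel kernelUnit; fun_prop, C * C, by finiteness,
    fun f₀ f₁ f₂ f₃ h₀ h₁ h₂ h₃ => ?_⟩
  have hb : ∀ s, ∫⁻ p, (jap (-(49 / 100)) (modulation p) *
      jap (-(49 / 100)) (modulation (s - p))) ^ 2 ∂freqMeasure ≤ C := by
    intro s
    refine le_trans (le_of_eq (lintegral_congr fun p => ?_)) (h s)
    rw [mul_pow, jap_pow_two, jap_pow_two, mul_neg]
  exact sq_quadForm_le_of_pairs
    (k := fun p q => jap (-(49 / 100)) (modulation p) * jap (-(49 / 100)) (modulation q))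
    (l := fun p q => jap (-(49 / 100)) (modulation p) * jap (-(49 / 100)) (modulation q))
    h₀ h₁ h₂ h₃ (by fun_prop) (by fun_prop) hb hb

theorem measurableSet_resonance :
    MeasurableSet {z : (ℤ × ℝ) × (ℤ × ℝ) × (ℤ × ℝ) | z.1.1 ≠ z.2.1.1 ∧ z.1.1 ≠ z.2.2.1} := by
  have : MeasurableSet {z : ℤ × ℤ × ℤ | z.1 ≠ z.2.1 ∧ z.1 ≠ z.2.2} := MeasurableSet.of_discrete
  exact (show Measurable fun z : (ℤ × ℝ) × (ℤ × ℝ) × (ℤ × ℝ) => (z.1.1, z.2.1.1, z.2.2.1) by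
    fun_prop) this

theorem boundedKernel_kernelZero : BoundedKernel kernelZero := by
  obtain ⟨C, hC, h⟩ := exists_lintegral_kernel_zero_le (p := 2 * (49 / 100))
    (by norm_num) (by norm_num)
  have hm : MeasurableKernel kernelZero := by
    unfold MeasurableKernel kernelZero
    exact Measurable.mul (Measurable.ite measurableSet_resonance (by fun_prop) measurable_const)
      (by fun_prop)
  refine ⟨hm, C, hC, fun f₀ f₁ f₂ f₃ h₀ h₁ h₂ h₃ => ?_⟩
  refine sq_quadForm_le_of_zero_outer h₀ h₁ h₂ h₃ hm fun p₀ => ?_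
  refine le_trans (le_of_eq (lintegral_congr fun p₁ => lintegral_congr fun p₂ => ?_)) (h p₀)
  unfold kernelZero
  rw [mul_pow, mul_pow, mul_pow, ite_pow, mul_pow]
  simp only [jap_pow_two, mul_neg]
  norm_num

/-- In `kernelOne` the squared weight `⟨ξ₂⟩⁻¹` just fails to be summable. If `⟨σ⟩ ≥ ⟨ξ⟩`, a little
modulation is traded for frequency decay; otherwise a little frequency decay is given up to make the
squared modulation weight integrable. -/
theorem jap_modulation_le_split (σ ξ : ℝ) :
    jap (-(49 / 100)) σ ≤ jap (-(48 / 100)) σ * jap (-(1 / 100)) ξ +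
      jap (-(51 / 100)) σ * jap (2 / 100) ξ := by
  rcases le_total (bracket ξ) (bracket σ) with h | h
  · refine le_trans ?_ le_self_add
    have e : jap (-(49 / 100)) σ = jap (-(48 / 100)) σ * jap (-(1 / 100)) σ := by
      rw [← jap_add]; norm_num
    rw [e]
    gcongr
    exact jap_anti_bracket (by norm_num) h
  · refine le_trans ?_ le_add_self
    have e : jap (-(49 / 100)) σ = jap (-(51 / 100)) σ * jap (2 / 100) σ := by
      rw [← jap_add]; norm_num
    rw [e]
    gcongr
    exact jap_mono_bracket (by norm_num) h

/-- The part of `kernelOne` where the modulation of `p₂` is large. -/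
def kernelOneHigh (p₀ p₁ p₂ : ℤ × ℝ) : ℝ≥0∞ :=
  jap (-(51 / 100)) p₂.1 * (jap (-(48 / 100)) (modulation p₂) *
    (jap (-(48 / 100)) (modulation p₀) * jap (-(48 / 100)) (modulation (p₁ + p₂ - p₀))))

/-- The part of `kernelOne` where the modulation of `p₂` is small. -/
def kernelOneLow (p₀ p₁ p₂ : ℤ × ℝ) : ℝ≥0∞ :=
  jap (-(49 / 100)) (modulation p₀) * jap (-(49 / 100)) (modulation (p₁ + p₂ - p₀)) *
    (jap (-(1 / 2)) p₁.1 * jap (-(48 / 100)) p₂.1 * jap (-(51 / 100)) (modulation p₂))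

/-- With `p₁` fixed, the squared weight in `ξ₂` has exponent `102/100 > 1`, and the modulations have
exponent `96/100 > 5/6`. -/
theorem boundedKernel_kernelOneHigh : BoundedKernel kernelOneHigh := by
  obtain ⟨C, hC, h⟩ := exists_lintegral_kernel_fst_le (p := 2 * (48 / 100)) (q := 2 * (51 / 100))
    (by norm_num) (by norm_num) (by norm_num)
  have hm : MeasurableKernel kernelOneHigh := by
    unfold MeasurableKernel kernelOneHigh
    fun_prop
  refine ⟨hm, C, hC, fun f₀ f₁ f₂ f₃ h₀ h₁ h₂ h₃ => ?_⟩
  refine sq_quadForm_le_of_one_outer h₀ h₁ h₂ h₃ hm fun p₁ => ?_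
  refine le_trans (le_of_eq (lintegral_congr fun p₂ => lintegral_congr fun p₀ => ?_)) (h p₁)
  unfold kernelOneHigh
  simp only [mul_pow, jap_pow_two, mul_neg]

/-- The pair `(p₀, p₃)` uses the Strichartz bound. The pair `(p₁, p₂)` uses the integrable exponent
`102/100` of `σ₂` and the frequency exponents `1 + 96/100 > 1`. -/
theorem boundedKernel_kernelOneLow : BoundedKernel kernelOneLow := by
  obtain ⟨C, hC, h⟩ := exists_lintegral_jap_modulation_pair_le (p := 2 * (49 / 100))
    (by norm_num) (by norm_num)
  obtain ⟨D, hD, h'⟩ := exists_lintegral_jap_pair_le (p := 2 * (1 / 2)) (q := 2 * (48 / 100))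
    (r := 2 * (51 / 100)) (by norm_num) (by norm_num) (by norm_num) (by norm_num)
  refine ⟨by unfold MeasurableKernel kernelOneLow; fun_prop, C * D, by finiteness,
    fun f₀ f₁ f₂ f₃ h₀ h₁ h₂ h₃ => ?_⟩
  refine sq_quadForm_le_of_pairs
    (k := fun p q => jap (-(49 / 100)) (modulation p) * jap (-(49 / 100)) (modulation q))
    (l := fun p q => jap (-(1 / 2)) p.1 * jap (-(48 / 100)) q.1 * jap (-(51 / 100)) (modulation q))
    h₀ h₁ h₂ h₃ (by fun_prop) (by fun_prop) (fun s => ?_) (fun s => ?_)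
  · refine le_trans (le_of_eq (lintegral_congr fun p => ?_)) (h s)
    rw [mul_pow, jap_pow_two, jap_pow_two, mul_neg]
  · refine le_trans (le_of_eq (lintegral_congr fun p => ?_)) (h' s)
    simp only [mul_pow, jap_pow_two, mul_neg]

theorem jap_neg_le_one {p : ℝ} (hp : 0 ≤ p) (x : ℝ) : jap (-p) x ≤ 1 := by
  rw [← jap_zero x]
  exact jap_mono_exp (by linarith) x

theorem boundedKernel_kernelOne : BoundedKernel kernelOne := by
  refine BoundedKernel.mono (by unfold MeasurableKernel kernelOne; fun_prop)
    (boundedKernel_kernelOneHigh.add boundedKernel_kernelOneLow) fun p₀ p₁ p₂ => ?_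
  unfold kernelOne kernelOneHigh kernelOneLow
  have e1 : jap (-(51 / 100)) (p₂.1 : ℝ) = jap (-(1 / 2)) p₂.1 * jap (-(1 / 100)) p₂.1 := by
    rw [← jap_add]; norm_num
  have e2 : jap (-(48 / 100)) (p₂.1 : ℝ) = jap (-(1 / 2)) p₂.1 * jap (2 / 100) p₂.1 := by
    rw [← jap_add]; norm_num
  have h0 : jap (-(49 / 100)) (modulation p₀) ≤ jap (-(48 / 100)) (modulation p₀) :=
    jap_mono_exp (by norm_num) _
  have h3 : jap (-(49 / 100)) (modulation (p₁ + p₂ - p₀)) ≤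
    jap (-(48 / 100)) (modulation (p₁ + p₂ - p₀)) := jap_mono_exp (by norm_num) _
  have h1 : jap (-(1 / 2)) (p₁.1 : ℝ) ≤ 1 := jap_neg_le_one (by norm_num) _
  calc _ ≤ jap (-(1 / 2)) p₁.1 * jap (-(1 / 2)) p₂.1 *
        ((jap (-(48 / 100)) (modulation p₂) * jap (-(1 / 100)) p₂.1 +
          jap (-(51 / 100)) (modulation p₂) * jap (2 / 100) p₂.1) *
        (jap (-(49 / 100)) (modulation p₀) * jap (-(49 / 100)) (modulation (p₁ + p₂ - p₀)))) := by
        gcongr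
        exact jap_modulation_le_split _ _
    _ = jap (-(1 / 2)) p₁.1 * (jap (-(1 / 2)) p₂.1 * jap (-(1 / 100)) p₂.1 *
          (jap (-(48 / 100)) (modulation p₂) *
          (jap (-(49 / 100)) (modulation p₀) * jap (-(49 / 100)) (modulation (p₁ + p₂ - p₀))))) +
        jap (-(49 / 100)) (modulation p₀) * jap (-(49 / 100)) (modulation (p₁ + p₂ - p₀)) *
          (jap (-(1 / 2)) p₁.1 * (jap (-(1 / 2)) p₂.1 * jap (2 / 100) p₂.1) *
            jap (-(51 / 100)) (modulation p₂)) := by ring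
    _ ≤ _ := by
        rw [← e1, ← e2]
        gcongr ?_ + _
        refine (mul_le_mul_left h1 _).trans ?_
        rw [one_mul]
        gcongr

/-! ### The multiplier -/

/-- This rests on `ξ₀ξ₃ = ξ₁ξ₂ - (ξ₀ - ξ₁)(ξ₀ - ξ₂)`. Integrality gives `⟨ξ₀⟩ ≤ 2|ξ₀|` for `ξ₀ ≠ 0`;
for `ξ₀ = 0` the triangle inequality for `ξ₃ = ξ₁ + ξ₂` is enough. -/
theorem bracket_mul_sq_le (ξ₀ ξ₁ ξ₂ : ℤ) :
    bracket ξ₀ * ((ξ₁ + ξ₂ - ξ₀ : ℤ) : ℝ) ^ 2 ≤ 2 * (bracket ξ₁ * bracket ξ₂ +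
      |((ξ₀ : ℝ) - ξ₁) * (ξ₀ - ξ₂)|) * bracket ((ξ₁ + ξ₂ - ξ₀ : ℤ) : ℝ) := by
  set ξ₃ : ℝ := ((ξ₁ + ξ₂ - ξ₀ : ℤ) : ℝ) with hξ₃
  have h3 : ξ₃ = ξ₁ + ξ₂ - ξ₀ := by rw [hξ₃]; push_cast; ring
  have hb3 := abs_le_bracket ξ₃
  have hb1 := abs_le_bracket ξ₁
  have hb2 := abs_le_bracket ξ₂
  have o1 := one_le_bracket ξ₁
  have o2 := one_le_bracket ξ₂
  have main : bracket ξ₀ * |ξ₃| ≤ 2 * (bracket ξ₁ * bracket ξ₂ +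
      |((ξ₀ : ℝ) - ξ₁) * (ξ₀ - ξ₂)|) := by
    by_cases h0 : ξ₀ = 0
    · have : bracket (ξ₀ : ℝ) = 1 := by simp [h0, bracket]
      rw [this, one_mul]
      have h4 : |ξ₃| ≤ |(ξ₁ : ℝ)| + |(ξ₂ : ℝ)| := by
        rw [h3, h0]
        simpa using abs_add_le (ξ₁ : ℝ) ξ₂
      nlinarith [abs_nonneg (((ξ₀ : ℝ) - ξ₁) * (ξ₀ - ξ₂))]
    · have h1 : (1 : ℝ) ≤ |(ξ₀ : ℝ)| := by exact_mod_cast Int.one_le_abs h0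
      have h2 := bracket_le_one_add_abs ξ₀
      have h4 : |(ξ₀ : ℝ)| * |ξ₃| ≤ |(ξ₁ : ℝ)| * |(ξ₂ : ℝ)| + |((ξ₀ : ℝ) - ξ₁) * (ξ₀ - ξ₂)| := by
        rw [← abs_mul, ← abs_mul]
        have : (ξ₀ : ℝ) * ξ₃ = ξ₁ * ξ₂ - ((ξ₀ : ℝ) - ξ₁) * (ξ₀ - ξ₂) := by rw [h3]; ring
        rw [this]
        exact abs_sub _ _
      have h5 : |(ξ₁ : ℝ)| * |(ξ₂ : ℝ)| ≤ bracket ξ₁ * bracket ξ₂ := by gcongr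
      have h6 : bracket ξ₀ * |ξ₃| ≤ 2 * (|(ξ₀ : ℝ)| * |ξ₃|) := by
        rw [← mul_assoc]
        gcongr
        linarith
      linarith
  calc _ = bracket ξ₀ * |ξ₃| * |ξ₃| := by rw [← sq_abs]; ring
    _ ≤ _ := by gcongr

/-- The `τ` variables cancel in `σ₀ - σ₁ - σ₂ + σ₃`, leaving `ξ₀² - ξ₁² - ξ₂² + ξ₃² = 2(ξ₀ - ξ₁)(ξ₀
- ξ₂)`. -/
theorem abs_resonance_le (p₀ p₁ p₂ : ℤ × ℝ) :
    2 * |((p₀.1 : ℝ) - p₁.1) * (p₀.1 - p₂.1)| ≤ bracket (modulation p₀) +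
      bracket (modulation p₁) + bracket (modulation p₂) + bracket (modulation (p₁ + p₂ - p₀)) := by
  have e : 2 * (((p₀.1 : ℝ) - p₁.1) * (p₀.1 - p₂.1)) =
      modulation p₀ - modulation p₁ - modulation p₂ + modulation (p₁ + p₂ - p₀) := by
    simp only [modulation, Prod.fst_add, Prod.fst_sub, Prod.snd_add, Prod.snd_sub]
    push_cast
    ring
  have h0 := abs_le_bracket (modulation p₀)
  have h1 := abs_le_bracket (modulation p₁)
  have h2 := abs_le_bracket (modulation p₂)
  have h3 := abs_le_bracket (modulation (p₁ + p₂ - p₀))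
  rw [← abs_two (α := ℝ), ← abs_mul, e]
  rw [abs_le] at *
  constructor <;> linarith

/-- The ratio of Sobolev weights, including the derivative on the third factor. -/
def multiplier (p₀ p₁ p₂ : ℤ × ℝ) : ℝ≥0∞ :=
  jap (1 / 2) p₀.1 * ENNReal.ofReal |((p₁ + p₂ - p₀).1 : ℝ)| *
    (jap (-(1 / 2)) p₁.1 * jap (-(1 / 2)) p₂.1 * jap (-(1 / 2)) (p₁ + p₂ - p₀).1)

theorem jap_one (x : ℝ) : jap 1 x = ENNReal.ofReal (bracket x) := by simp [jap]

/-- The indicator costs nothing, since the product `(ξ₀ - ξ₁)(ξ₀ - ξ₂)` vanishes where it does. It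
is kept because `kernelZero` needs nonzero slopes. -/
theorem multiplier_sq_le (p₀ p₁ p₂ : ℤ × ℝ) :
    multiplier p₀ p₁ p₂ ^ 2 ≤ 2 + (if p₀.1 ≠ p₁.1 ∧ p₀.1 ≠ p₂.1 then
      jap (-1) p₁.1 * jap (-1) p₂.1 else 0) * (jap 1 (modulation p₀) + jap 1 (modulation p₁) +
        jap 1 (modulation p₂) + jap 1 (modulation (p₁ + p₂ - p₀))) := by
  have hd : 2 * |((p₀.1 : ℝ) - p₁.1) * (p₀.1 - p₂.1)| ≤
      if p₀.1 ≠ p₁.1 ∧ p₀.1 ≠ p₂.1 then bracket (modulation p₀) +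
      bracket (modulation p₁) + bracket (modulation p₂) + bracket (modulation (p₁ + p₂ - p₀))
      else 0 := by
    split_ifs with h
    · exact abs_resonance_le p₀ p₁ p₂
    · rw [not_and_or, not_not, not_not] at h
      rcases h with h | h <;> simp [h]
  set R := bracket (modulation p₀) + bracket (modulation p₁) + bracket (modulation p₂) +
    bracket (modulation (p₁ + p₂ - p₀)) with hR
  have hR' : ENNReal.ofReal R = jap 1 (modulation p₀) + jap 1 (modulation p₁) +
        jap 1 (modulation p₂) + jap 1 (modulation (p₁ + p₂ - p₀)) := by
    simp only [jap_one, hR]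
    have a0 := (bracket_pos (modulation p₀)).le
    have a1 := (bracket_pos (modulation p₁)).le
    have a2 := (bracket_pos (modulation p₂)).le
    have a3 := (bracket_pos (modulation (p₁ + p₂ - p₀))).le
    rw [ENNReal.ofReal_add (by positivity) a3, ENNReal.ofReal_add (by positivity) a2,
      ENNReal.ofReal_add a0 a1]
  have hb := bracket_mul_sq_le p₀.1 p₁.1 p₂.1
  set ξ₃ : ℤ := p₁.1 + p₂.1 - p₀.1
  have hp3 : (p₁ + p₂ - p₀).1 = ξ₃ := rfl
  have h0 : 0 ≤ bracket p₀.1 := (bracket_pos _).le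
  have h1 : 0 < bracket p₁.1 := bracket_pos _
  have h2 : 0 < bracket p₂.1 := bracket_pos _
  have h3 : 0 < bracket ξ₃ := bracket_pos _
  have key : bracket p₀.1 * |(ξ₃ : ℝ)| ^ 2 * ((bracket p₁.1)⁻¹ * (bracket p₂.1)⁻¹ *
      (bracket ξ₃)⁻¹) ≤ 2 + (if p₀.1 ≠ p₁.1 ∧ p₀.1 ≠ p₂.1 then
      (bracket p₁.1)⁻¹ * (bracket p₂.1)⁻¹ else 0) * R := by
    have : bracket p₀.1 * |(ξ₃ : ℝ)| ^ 2 ≤ (2 * (bracket p₁.1 * bracket p₂.1) +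
        if p₀.1 ≠ p₁.1 ∧ p₀.1 ≠ p₂.1 then R else 0) * bracket ξ₃ := by
      rw [sq_abs]
      refine hb.trans ?_
      gcongr
      linarith
    calc _ ≤ _ := mul_le_mul_of_nonneg_right this (by positivity)
      _ = _ := by
        split_ifs
        · field_simp
        · field_simp
          ring
  unfold multiplier
  rw [hp3, ← hR']
  have i : ∀ x : ℝ, jap (-1) x = ENNReal.ofReal (bracket x)⁻¹ := by
    intro x
    simp only [jap, Real.rpow_neg_one]
  calc _ = ENNReal.ofReal (bracket p₀.1 * |(ξ₃ : ℝ)| ^ 2 * ((bracket p₁.1)⁻¹ * (bracket p₂.1)⁻¹ *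
      (bracket ξ₃)⁻¹)) := by
        simp only [mul_pow, jap_pow_two, mul_neg]
        norm_num only
        rw [i, i, i, jap_one, ENNReal.ofReal_mul (by positivity), ENNReal.ofReal_mul h0,
          ENNReal.ofReal_mul (by positivity), ENNReal.ofReal_mul (by positivity),
          ENNReal.ofReal_pow (abs_nonneg _)]
    _ ≤ _ := ENNReal.ofReal_le_ofReal key
    _ ≤ _ := by
        refine ENNReal.ofReal_add_le.trans ?_
        gcongr
        · norm_num
        · split_ifs
          · rw [ENNReal.ofReal_mul (by positivity), ENNReal.ofReal_mul (by positivity), i, i]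
          · simp

theorem le_of_sq_le_sq {a b : ℝ≥0∞} (h : a ^ 2 ≤ b ^ 2) : a ≤ b := by
  by_contra! hc
  exact absurd h (not_le.2 (by gcongr))

theorem multiplier_le (p₀ p₁ p₂ : ℤ × ℝ) :
    multiplier p₀ p₁ p₂ ≤ 2 + (if p₀.1 ≠ p₁.1 ∧ p₀.1 ≠ p₂.1 then
      jap (-(1 / 2)) p₁.1 * jap (-(1 / 2)) p₂.1 else 0) *
        (jap (1 / 2) (modulation p₀) + jap (1 / 2) (modulation p₁) +
        jap (1 / 2) (modulation p₂) + jap (1 / 2) (modulation (p₁ + p₂ - p₀))) := by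
  -- This lets the square root be taken term by term.
  have aux : ∀ a b : ℝ≥0∞, a ^ 2 + b ^ 2 ≤ (a + b) ^ 2 := fun a b => by
    rw [add_sq, add_right_comm]
    exact le_self_add
  refine le_of_sq_le_sq ((multiplier_sq_le p₀ p₁ p₂).trans ?_)
  refine le_trans ?_ (aux _ _)
  gcongr
  · norm_num
  · have e : ∀ x : ℝ, jap 1 x = jap (1 / 2) x ^ 2 := fun x => by rw [jap_pow_two]; norm_num
    have e' : ∀ x : ℝ, jap (-1) x = jap (-(1 / 2)) x ^ 2 := fun x => by
      rw [jap_pow_two]; norm_num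
    rw [mul_pow, ite_pow, mul_pow, e, e, e, e, e', e', zero_pow two_ne_zero]
    gcongr
    refine le_trans ?_ (aux _ _)
    gcongr
    refine le_trans ?_ (aux _ _)
    gcongr
    exact aux _ _

/-! ### The weighted quadrilinear estimate -/

/-- A kernel whose quadrilinear form gains the factor `θ` by which a small power of the modulation
improves the norms of the first and of the second function. -/
structure GainKernel (K : ℤ × ℝ → ℤ × ℝ → ℤ × ℝ → ℝ≥0∞) : Prop where
  measurable : MeasurableKernel K
  bound : ∃ C : ℝ≥0∞, C ≠ ⊤ ∧ ∀ (θ : ℝ≥0∞) (f₀ f₁ f₂ f₃ : ℤ × ℝ → ℝ≥0∞), Measurable f₀ →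
    Measurable f₁ → Measurable f₂ → Measurable f₃ →
    sqNorm (fun p => jap (-(1 / 100)) (modulation p) * f₁ p) ≤ θ * sqNorm f₁ →
    sqNorm (fun p => jap (-(1 / 100)) (modulation p) * f₂ p) ≤ θ * sqNorm f₂ →
    quadForm f₀ f₁ f₂ f₃ K ^ 2 ≤ C * θ * (sqNorm f₀ * (sqNorm f₁ * sqNorm f₂ * sqNorm f₃))

section

variable {K L : ℤ × ℝ → ℤ × ℝ → ℤ × ℝ → ℝ≥0∞}

theorem GainKernel.mono (hK : MeasurableKernel K) (hL : GainKernel L)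
    (h : ∀ p₀ p₁ p₂, K p₀ p₁ p₂ ≤ L p₀ p₁ p₂) : GainKernel K := by
  obtain ⟨C, hC, hb⟩ := hL.bound
  refine ⟨hK, C, hC, fun θ f₀ f₁ f₂ f₃ h₀ h₁ h₂ h₃ g₁ g₂ => ?_⟩
  exact (pow_le_pow_left' (quadForm_mono h) 2).trans (hb _ _ _ _ _ h₀ h₁ h₂ h₃ g₁ g₂)

theorem GainKernel.add (hK : GainKernel K) (hL : GainKernel L) :
    GainKernel fun p₀ p₁ p₂ => K p₀ p₁ p₂ + L p₀ p₁ p₂ := by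
  obtain ⟨C, hC, hb⟩ := hK.bound
  obtain ⟨D, hD, hd⟩ := hL.bound
  refine ⟨Measurable.add hK.measurable hL.measurable, 2 * (C + D), by finiteness,
    fun θ f₀ f₁ f₂ f₃ h₀ h₁ h₂ h₃ g₁ g₂ => ?_⟩
  rw [quadForm_add h₀ h₁ h₂ h₃ hK.measurable]
  refine (add_sq_le_two_mul_sq_add_sq _ _).trans ?_
  rw [mul_assoc, mul_assoc, add_mul, ← mul_assoc C, ← mul_assoc D]
  gcongr
  · exact hb _ _ _ _ _ h₀ h₁ h₂ h₃ g₁ g₂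
  · exact hd _ _ _ _ _ h₀ h₁ h₂ h₃ g₁ g₂

theorem BoundedKernel.gain_one (hK : BoundedKernel K) :
    GainKernel fun p₀ p₁ p₂ => jap (-(1 / 100)) (modulation p₁) * K p₀ p₁ p₂ := by
  obtain ⟨C, hC, hb⟩ := hK.bound
  refine ⟨Measurable.mul (by fun_prop) hK.measurable, C, hC,
    fun θ f₀ f₁ f₂ f₃ h₀ h₁ h₂ h₃ g₁ g₂ => ?_⟩
  have e : quadForm f₀ f₁ f₂ f₃
      (fun p₀ p₁ p₂ => jap (-(1 / 100)) (modulation p₁) * K p₀ p₁ p₂) =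
      quadForm f₀ (fun p => jap (-(1 / 100)) (modulation p) * f₁ p) f₂ f₃ K := by
    unfold quadForm
    refine lintegral_congr fun p₀ => lintegral_congr fun p₁ => lintegral_congr fun p₂ => ?_
    ring
  rw [e]
  calc _ ≤ _ := hb _ _ _ _ h₀ (by fun_prop) h₂ h₃
    _ ≤ C * (sqNorm f₀ * (θ * sqNorm f₁ * sqNorm f₂ * sqNorm f₃)) := by gcongr
    _ = _ := by ring

theorem BoundedKernel.gain_two (hK : BoundedKernel K) :
    GainKernel fun p₀ p₁ p₂ => jap (-(1 / 100)) (modulation p₂) * K p₀ p₁ p₂ := by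
  obtain ⟨C, hC, hb⟩ := hK.bound
  refine ⟨Measurable.mul (by fun_prop) hK.measurable, C, hC,
    fun θ f₀ f₁ f₂ f₃ h₀ h₁ h₂ h₃ g₁ g₂ => ?_⟩
  have e : quadForm f₀ f₁ f₂ f₃
      (fun p₀ p₁ p₂ => jap (-(1 / 100)) (modulation p₂) * K p₀ p₁ p₂) =
      quadForm f₀ f₁ (fun p => jap (-(1 / 100)) (modulation p) * f₂ p) f₃ K := by
    unfold quadForm
    refine lintegral_congr fun p₀ => lintegral_congr fun p₁ => lintegral_congr fun p₂ => ?_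
    ring
  rw [e]
  calc _ ≤ _ := hb _ _ _ _ h₀ h₁ (by fun_prop) h₃
    _ ≤ C * (sqNorm f₀ * (sqNorm f₁ * (θ * sqNorm f₂) * sqNorm f₃)) := by gcongr
    _ = _ := by ring

end

/-- The full kernel of the trilinear estimate, tested against a fourth function. -/
def fullKernel (p₀ p₁ p₂ : ℤ × ℝ) : ℝ≥0∞ :=
  multiplier p₀ p₁ p₂ * (jap (-(1 / 2)) (modulation p₀) * jap (-(1 / 2)) (modulation p₁) *
    jap (-(1 / 2)) (modulation p₂) * jap (-(1 / 2)) (modulation (p₁ + p₂ - p₀)))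

theorem resonance_reflect_iff (p₀ p₁ p₂ : ℤ × ℝ) :
    ((p₁ + p₂ - p₀).1 ≠ p₁.1 ∧ (p₁ + p₂ - p₀).1 ≠ p₂.1) ↔ (p₀.1 ≠ p₁.1 ∧ p₀.1 ≠ p₂.1) := by
  simp only [Prod.fst_add, Prod.fst_sub]
  omega

/-- Each term of `multiplier_le` cancels at most one factor `⟨σ_j⟩^(-1/2)`. The spare `⟨σ⟩^(-1/100)`
is taken from `σ₁`, or from `σ₂` in the term where `σ₁` is the modulation spent. -/
theorem gainKernel_fullKernel : GainKernel fullKernel := by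
  have hU := boundedKernel_kernelUnit.gain_one
  have h0 := boundedKernel_kernelZero.gain_one
  have h1 := boundedKernel_kernelOne.gain_two
  have h2 := boundedKernel_kernelOne.swap_one_two.gain_one
  have h3 := boundedKernel_kernelZero.swap_zero_three.gain_one
  refine GainKernel.mono (by unfold MeasurableKernel fullKernel multiplier; fun_prop)
    -- Two copies of `hU` account for the constant 2; the others belong to the spent modulations
    -- `σ₀`, `σ₁`, `σ₂`, `σ₃`.
    ((hU.add hU).add (((h0.add h1).add h2).add h3)) fun p₀ p₁ p₂ => ?_
  simp only [kernelUnit, kernelZero, kernelOne, sub_sub_cancel, resonance_reflect_iff,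
    add_comm p₂ p₁]
  unfold fullKernel
  set s₀ := modulation p₀
  set s₁ := modulation p₁
  set s₂ := modulation p₂
  set s₃ := modulation (p₁ + p₂ - p₀)
  have split : ∀ s : ℝ, jap (-(1 / 2)) s = jap (-(1 / 100)) s * jap (-(49 / 100)) s := fun s => by
    rw [← jap_add]; norm_num
  have le : ∀ s : ℝ, jap (-(1 / 2)) s ≤ jap (-(49 / 100)) s := fun s =>
    jap_mono_exp (by norm_num) s
  have inv : ∀ s : ℝ, jap (1 / 2) s * jap (-(1 / 2)) s = 1 := fun s => by
    rw [← jap_add]; simp [jap_zero]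
  set W : ℝ≥0∞ := if p₀.1 ≠ p₁.1 ∧ p₀.1 ≠ p₂.1 then
      jap (-(1 / 2)) p₁.1 * jap (-(1 / 2)) p₂.1 else 0 with hW
  have hW1 : W ≤ jap (-(1 / 2)) p₁.1 * jap (-(1 / 2)) p₂.1 := by
    rw [hW]
    split_ifs
    · exact le_rfl
    · exact zero_le
  set H : ℝ → ℝ≥0∞ := jap (-(1 / 2))
  set B : ℝ → ℝ≥0∞ := jap (-(49 / 100))
  set E : ℝ → ℝ≥0∞ := jap (-(1 / 100))
  have expand : (2 + W * (jap (1 / 2) s₀ + jap (1 / 2) s₁ + jap (1 / 2) s₂ + jap (1 / 2) s₃)) *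
      (H s₀ * H s₁ * H s₂ * H s₃) =
      2 * (H s₁ * (H s₀ * H s₂ * H s₃)) + W * (H s₁ * H s₂ * H s₃) + W * (H s₂ * H s₀ * H s₃) +
        W * (H s₁ * H s₀ * H s₃) + W * (H s₁ * H s₂ * H s₀) := by
    calc _ = 2 * (H s₁ * (H s₀ * H s₂ * H s₃)) +
          (jap (1 / 2) s₀ * H s₀) * (W * (H s₁ * H s₂ * H s₃)) +
          (jap (1 / 2) s₁ * H s₁) * (W * (H s₂ * H s₀ * H s₃)) +
          (jap (1 / 2) s₂ * H s₂) * (W * (H s₁ * H s₀ * H s₃)) +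
          (jap (1 / 2) s₃ * H s₃) * (W * (H s₁ * H s₂ * H s₀)) := by ring
      _ = _ := by rw [inv, inv, inv, inv]; ring
  calc _ ≤ _ := mul_le_mul_left (multiplier_le p₀ p₁ p₂) _
    _ = _ := expand
    _ ≤ 2 * ((E s₁ * B s₁) * (B s₀ * B s₂ * B s₃)) + W * ((E s₁ * B s₁) * B s₂ * B s₃) +
        (H p₁.1 * H p₂.1) * ((E s₂ * B s₂) * B s₀ * B s₃) +
        (H p₁.1 * H p₂.1) * ((E s₁ * B s₁) * B s₀ * B s₃) +
        W * ((E s₁ * B s₁) * B s₂ * B s₀) := by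
        rw [← split, ← split]
        gcongr <;> exact le _
    _ = _ := by ring

/-! ### The Fourier transform in time -/

/-- The normalizing constant `(2π)^{-1/2}`. -/
def fourierConst : ℝ := (2 * Real.pi) ^ (-(1 / 2) : ℝ)

theorem fourierConst_pos : 0 < fourierConst := by
  unfold fourierConst
  positivity

theorem fourierConst_mul_self : fourierConst * fourierConst = (2 * Real.pi)⁻¹ := by
  unfold fourierConst
  rw [← Real.rpow_add (by positivity)]
  norm_num
  rw [Real.rpow_neg_one, mul_inv, mul_comm, one_div]

theorem fourierT_eq_fourier (g : ℝ → ℂ) (τ : ℝ) :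
    fourierT g τ = fourierConst * FourierTransform.fourier g (τ / (2 * Real.pi)) := by
  unfold fourierT
  rw [Real.fourier_real_eq_integral_exp_smul]
  congr 1
  refine integral_congr_ae (Filter.Eventually.of_forall fun t => ?_)
  have : (Real.pi : ℂ) ≠ 0 := by exact_mod_cast Real.pi_ne_zero
  simp only [smul_eq_mul]
  congr 2
  push_cast
  field_simp


theorem fourier_eq_schwartz {g : ℝ → ℂ} (hs : HasCompactSupport g) (hd : ContDiff ℝ ∞ g) :
    FourierTransform.fourier g = ⇑(FourierTransform.fourier (hs.toSchwartzMap hd)) := rfl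

theorem continuous_fourierT {g : ℝ → ℂ} (hs : HasCompactSupport g) (hd : ContDiff ℝ ∞ g) :
    Continuous (fourierT g) := by
  rw [funext (fourierT_eq_fourier g), fourier_eq_schwartz hs hd]
  exact continuous_const.mul ((SchwartzMap.continuous _).comp (by fun_prop))

theorem fourierT_inversion {g : ℝ → ℂ} (hs : HasCompactSupport g) (hd : ContDiff ℝ ∞ g) (t : ℝ) :
    g t = fourierConst * ∫ τ : ℝ, Complex.exp (Complex.I * t * τ) * fourierT g τ := by
  have hi : Integrable g := hd.continuous.integrable_of_hasCompactSupport hs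
  have hF : Integrable (FourierTransform.fourier g) := by
    rw [fourier_eq_schwartz hs hd]
    exact SchwartzMap.integrable _
  have h := congrFun (hd.continuous.fourierInv_fourier_eq hi hF) t
  rw [Real.fourierInv_eq'] at h
  have h2 := Measure.integral_comp_div (fun w : ℝ => Complex.exp
    (((2 * Real.pi * inner ℝ w t : ℝ) : ℂ) * Complex.I) • FourierTransform.fourier g w)
    (2 * Real.pi)
  rw [h, abs_of_pos (by positivity)] at h2
  have e : ∀ τ : ℝ, Complex.exp (Complex.I * t * τ) * fourierT g τ = fourierConst *
      (Complex.exp (((2 * Real.pi * inner ℝ (τ / (2 * Real.pi)) t : ℝ) : ℂ) * Complex.I) •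
        FourierTransform.fourier g (τ / (2 * Real.pi))) := by
    intro τ
    have hpi : (Real.pi : ℂ) ≠ 0 := by exact_mod_cast Real.pi_ne_zero
    rw [fourierT_eq_fourier, smul_eq_mul, mul_left_comm]
    congr 3
    simp only [RCLike.inner_apply, conj_trivial]
    push_cast
    field_simp
  simp_rw [e]
  rw [integral_const_mul, h2, ← mul_assoc, ← Complex.ofReal_mul, fourierConst_mul_self,
    Complex.real_smul, ← mul_assoc, ← Complex.ofReal_mul, inv_mul_cancel₀ (by positivity)]
  simp

theorem integral_norm_sq_fourierT {g : ℝ → ℂ} (hs : HasCompactSupport g) (hd : ContDiff ℝ ∞ g) :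
    ∫ τ : ℝ, ‖fourierT g τ‖ ^ 2 = ∫ t : ℝ, ‖g t‖ ^ 2 := by
  have h := SchwartzMap.integral_norm_sq_fourier (hs.toSchwartzMap hd)
  have h2 := Measure.integral_comp_div (fun w : ℝ => ‖FourierTransform.fourier g w‖ ^ 2)
    (2 * Real.pi)
  rw [abs_of_pos (by positivity)] at h2
  have e : ∀ τ : ℝ, ‖fourierT g τ‖ ^ 2 = (2 * Real.pi)⁻¹ *
      ‖FourierTransform.fourier g (τ / (2 * Real.pi))‖ ^ 2 := by
    intro τ
    rw [fourierT_eq_fourier, norm_mul, Complex.norm_real, mul_pow, sq ‖fourierConst‖,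
      Real.norm_of_nonneg fourierConst_pos.le, fourierConst_mul_self]
  simp_rw [e]
  rw [integral_const_mul, h2, smul_eq_mul, ← mul_assoc, inv_mul_cancel₀ (by positivity), one_mul]
  exact h

theorem integrable_norm_sq_fourierT {g : ℝ → ℂ} (hs : HasCompactSupport g)
    (hd : ContDiff ℝ ∞ g) : Integrable fun τ : ℝ => ‖fourierT g τ‖ ^ 2 := by
  have h := ((SchwartzMap.memLp (FourierTransform.fourier (hs.toSchwartzMap hd)) 2
    volume).integrable_norm_pow two_ne_zero).comp_div (show 2 * Real.pi ≠ 0 by positivity)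
  have e : ∀ τ : ℝ, ‖fourierT g τ‖ ^ 2 = fourierConst ^ 2 *
      ‖(FourierTransform.fourier (hs.toSchwartzMap hd)) (τ / (2 * Real.pi))‖ ^ 2 := by
    intro τ
    rw [fourierT_eq_fourier, norm_mul, Complex.norm_real, mul_pow,
      Real.norm_of_nonneg fourierConst_pos.le, fourier_eq_schwartz hs hd]
  simp_rw [e]
  exact h.const_mul _

theorem fourierT_deriv {g : ℝ → ℂ} (hs : HasCompactSupport g) (hd : ContDiff ℝ ∞ g) (τ : ℝ) :
    fourierT (deriv g) τ = Complex.I * τ * fourierT g τ := by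
  have hi : Integrable g := hd.continuous.integrable_of_hasCompactSupport hs
  have hi' : Integrable (deriv g) :=
    (hd.continuous_deriv (by simp)).integrable_of_hasCompactSupport hs.deriv
  have h := Real.fourier_deriv hi (hd.differentiable (by simp)) hi'
  have hpi : (Real.pi : ℂ) ≠ 0 := by exact_mod_cast Real.pi_ne_zero
  rw [fourierT_eq_fourier, fourierT_eq_fourier, h]
  simp only [smul_eq_mul]
  push_cast
  field_simp

/-- The transform of a function supported in `[-T, T]` is small in `L^∞` compared to `L²`. -/
theorem norm_sq_fourierT_le {g : ℝ → ℂ} {T : ℝ} (hT : 0 < T) (hg : ∀ t, T < |t| → g t = 0)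
    (hd : ContDiff ℝ ∞ g) (τ : ℝ) :
    ‖fourierT g τ‖ ^ 2 ≤ T / Real.pi * ∫ t : ℝ, ‖g t‖ ^ 2 := by
  have h1 : ‖fourierT g τ‖ ≤ fourierConst * ∫ t : ℝ, ‖g t‖ := by
    unfold fourierT
    rw [norm_mul, Complex.norm_real, Real.norm_of_nonneg (by positivity)]
    refine mul_le_mul_of_nonneg_left ?_ (by positivity)
    refine (norm_integral_le_integral_norm _).trans (le_of_eq ?_)
    refine integral_congr_ae (Filter.Eventually.of_forall fun t => ?_)
    simp only [norm_mul, Complex.norm_exp]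
    simp
  have h2 : (∫ t : ℝ, ‖g t‖) ^ 2 ≤ 2 * T * ∫ t : ℝ, ‖g t‖ ^ 2 := by
    have hz : ∀ t, t ∉ Set.Icc (-T) T → g t = 0 := fun t ht => hg t (by
      rw [Set.mem_Icc, ← abs_le] at ht
      linarith)
    have e1 : ∫ t : ℝ, ‖g t‖ = ∫ t in Set.Icc (-T) T, ‖g t‖ :=
      (setIntegral_eq_integral_of_forall_compl_eq_zero fun t ht => by simp [hz t ht]).symm
    have e2 : ∫ t : ℝ, ‖g t‖ ^ 2 = ∫ t in Set.Icc (-T) T, ‖g t‖ ^ 2 :=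
      (setIntegral_eq_integral_of_forall_compl_eq_zero fun t ht => by simp [hz t ht]).symm
    have hsq : IntegrableOn (fun t => ‖g t‖ ^ 2) (Set.Icc (-T) T) :=
      (by have := hd.continuous; fun_prop : Continuous fun t => ‖g t‖ ^ 2).integrableOn_Icc
    have hn : IntegrableOn (fun t => ‖g t‖) (Set.Icc (-T) T) :=
      (by have := hd.continuous; fun_prop : Continuous fun t => ‖g t‖).integrableOn_Icc
    rw [e1, e2]
    set A := ∫ t in Set.Icc (-T) T, ‖g t‖
    -- `m` is the mean of `‖g‖` over `[-T, T]`; nonnegativity of the variance is the Cauchy–Schwarz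
    -- inequality sought.
    set m := A / (2 * T)
    have hpos : 0 ≤ ∫ t in Set.Icc (-T) T, (‖g t‖ - m) ^ 2 :=
      integral_nonneg fun t => sq_nonneg _
    have hexp : ∫ t in Set.Icc (-T) T, (‖g t‖ - m) ^ 2 =
        (∫ t in Set.Icc (-T) T, ‖g t‖ ^ 2) - 2 * m * A + 2 * T * m ^ 2 := by
      have : ∀ t, (‖g t‖ - m) ^ 2 = ‖g t‖ ^ 2 - 2 * m * ‖g t‖ + m ^ 2 := fun t => by ring
      simp_rw [this]
      have hsub : IntegrableOn (fun t => ‖g t‖ ^ 2 - 2 * m * ‖g t‖) (Set.Icc (-T) T) :=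
        hsq.sub (hn.const_mul _)
      rw [integral_add hsub (integrableOn_const (by simp)),
        integral_sub hsq (hn.const_mul _), integral_const_mul, setIntegral_const]
      simp only [Real.volume_real_Icc, smul_eq_mul]
      rw [max_eq_left (by linarith)]
      ring
    have hm : 2 * T * m = A := by
      simp only [m]
      field_simp
    rw [hexp] at hpos
    have : 0 ≤ 2 * T * ((∫ t in Set.Icc (-T) T, ‖g t‖ ^ 2) - 2 * m * A + 2 * T * m ^ 2) := by
      positivity
    nlinarith
  calc ‖fourierT g τ‖ ^ 2 ≤ (fourierConst * ∫ t : ℝ, ‖g t‖) ^ 2 := by gcongr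
    _ = (2 * Real.pi)⁻¹ * (∫ t : ℝ, ‖g t‖) ^ 2 := by
        rw [mul_pow, sq fourierConst, fourierConst_mul_self]
    _ ≤ (2 * Real.pi)⁻¹ * (2 * T * ∫ t : ℝ, ‖g t‖ ^ 2) := by gcongr
    _ = _ := by field_simp

/-! ### Gain from short time support -/

/-- Uncertainty principle: the sup bound on the transform leaves at most half of the `L²` mass
within distance comparable to `1/T` of `-ρ`. The other half sits where the weight is at least
comparable to `1/T`. -/
theorem lintegral_enorm_sq_fourierT_le {g : ℝ → ℂ} {T : ℝ} (hT : 0 < T)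
    (hg : ∀ t, T < |t| → g t = 0) (hs : HasCompactSupport g) (hd : ContDiff ℝ ∞ g) (ρ : ℝ) :
    ∫⁻ τ : ℝ, ‖fourierT g τ‖ₑ ^ 2 ≤
      ENNReal.ofReal (3 * T) * ∫⁻ τ : ℝ, jap 1 (τ + ρ) * ‖fourierT g τ‖ₑ ^ 2 := by
  set A := ∫ t : ℝ, ‖g t‖ ^ 2
  set B := ∫⁻ τ : ℝ, jap 1 (τ + ρ) * ‖fourierT g τ‖ₑ ^ 2
  have hA0 : 0 ≤ A := integral_nonneg fun t => by positivity
  have hpi := Real.pi_pos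
  have e : ∀ τ : ℝ, ‖fourierT g τ‖ₑ ^ 2 = ENNReal.ofReal (‖fourierT g τ‖ ^ 2) := fun τ => by
    rw [ENNReal.ofReal_pow (norm_nonneg _), ofReal_norm]
  have hA : ∫⁻ τ : ℝ, ‖fourierT g τ‖ₑ ^ 2 = ENNReal.ofReal A := by
    simp_rw [e]
    rw [← ofReal_integral_eq_lintegral_ofReal (integrable_norm_sq_fourierT hs hd)
      (Filter.Eventually.of_forall fun τ => by positivity), integral_norm_sq_fourierT hs hd]
  -- The interval of length `2R = π/(2T)`, times the sup bound `(T/π)A`, contributes exactly `A/2`.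
  set R := Real.pi / (4 * T) with hR
  have hR0 : 0 < R := by positivity
  have key : ∀ τ : ℝ, ‖fourierT g τ‖ₑ ^ 2 ≤
      (Set.Icc (-ρ - R) (-ρ + R)).indicator (fun _ => ENNReal.ofReal (T / Real.pi * A)) τ +
        ENNReal.ofReal R⁻¹ * (jap 1 (τ + ρ) * ‖fourierT g τ‖ₑ ^ 2) := by
    intro τ
    by_cases hτ : τ ∈ Set.Icc (-ρ - R) (-ρ + R)
    · rw [Set.indicator_of_mem hτ]
      refine le_trans ?_ le_self_add
      rw [e]
      exact ENNReal.ofReal_le_ofReal (norm_sq_fourierT_le hT hg hd τ)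
    · refine le_trans ?_ le_add_self
      rw [← mul_assoc]
      refine le_mul_of_one_le_left zero_le ?_
      rw [jap_one, ← ENNReal.ofReal_mul (by positivity), ENNReal.one_le_ofReal,
        ← div_eq_inv_mul, one_le_div hR0]
      refine le_trans ?_ (abs_le_bracket _)
      by_contra! hc
      rw [abs_lt] at hc
      exact hτ ⟨by linarith, by linarith⟩
  have hm : Measurable (fourierT g) := (continuous_fourierT hs hd).measurable
  have h1 : ENNReal.ofReal A ≤ ENNReal.ofReal (A / 2) + ENNReal.ofReal R⁻¹ * B := by
    calc _ = ∫⁻ τ : ℝ, ‖fourierT g τ‖ₑ ^ 2 := hA.symm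
      _ ≤ _ := lintegral_mono key
      _ = _ := by
        rw [lintegral_add_left (measurable_const.indicator measurableSet_Icc),
          lintegral_indicator measurableSet_Icc, setLIntegral_const, Real.volume_Icc,
          ← ENNReal.ofReal_mul (by positivity), lintegral_const_mul _ (by fun_prop)]
        congr 2
        rw [hR]
        field_simp
        ring
  have h2 : ENNReal.ofReal (A / 2) ≤ ENNReal.ofReal R⁻¹ * B := by
    have : ENNReal.ofReal A = ENNReal.ofReal (A / 2) + ENNReal.ofReal (A / 2) := by
      rw [← ENNReal.ofReal_add (by positivity) (by positivity), add_halves]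
    rw [this] at h1
    exact ENNReal.le_of_add_le_add_left ENNReal.ofReal_ne_top h1
  rw [hA]
  calc ENNReal.ofReal A = 2 * ENNReal.ofReal (A / 2) := by
        rw [← ENNReal.ofReal_ofNat, ← ENNReal.ofReal_mul (by norm_num)]
        congr 1
        ring
    _ ≤ 2 * (ENNReal.ofReal R⁻¹ * B) := by gcongr
    _ = ENNReal.ofReal (2 * R⁻¹) * B := by
        rw [ENNReal.ofReal_mul (by norm_num), ENNReal.ofReal_ofNat, mul_assoc]
    _ ≤ _ := by
        -- `2/R = 8T/π ≤ 3T`.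
        refine mul_le_mul_left (ENNReal.ofReal_le_ofReal ?_) _
        rw [hR, inv_div, ← mul_div_assoc, div_le_iff₀ hpi]
        nlinarith [Real.pi_gt_three]

/-- The two terms cover `⟨x⟩ ≥ 1/T` and `⟨x⟩ ≤ 1/T`. The second, paired with the factor `3T` of the
unweighted bound, also gives `T^(1/50)`. -/
theorem jap_le_interpolate {T : ℝ} (hT : 0 < T) (x : ℝ) :
    jap (49 / 50) x ≤ ENNReal.ofReal (T ^ (1 / 50 : ℝ)) * jap 1 x +
      ENNReal.ofReal (T ^ (-(49 / 50) : ℝ)) := by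
  have hb := bracket_pos x
  rcases le_total T⁻¹ (bracket x) with h | h
  · refine le_trans ?_ le_self_add
    have e : jap (49 / 50) x = jap (-(1 / 50)) x * jap 1 x := by rw [← jap_add]; norm_num
    rw [e]
    gcongr
    unfold jap
    refine ENNReal.ofReal_le_ofReal ?_
    calc bracket x ^ (-(1 / 50) : ℝ) ≤ T⁻¹ ^ (-(1 / 50) : ℝ) :=
          Real.rpow_le_rpow_of_nonpos (by positivity) h (by norm_num)
      _ = _ := by rw [Real.inv_rpow hT.le, Real.rpow_neg hT.le, inv_inv]
  · refine le_trans ?_ le_add_self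
    unfold jap
    refine ENNReal.ofReal_le_ofReal ?_
    calc bracket x ^ (49 / 50 : ℝ) ≤ T⁻¹ ^ (49 / 50 : ℝ) :=
          Real.rpow_le_rpow hb.le h (by norm_num)
      _ = _ := by rw [Real.inv_rpow hT.le, Real.rpow_neg hT.le]

theorem lintegral_jap_fourierT_gain {g : ℝ → ℂ} {T : ℝ} (hT : 0 < T)
    (hg : ∀ t, T < |t| → g t = 0) (hs : HasCompactSupport g) (hd : ContDiff ℝ ∞ g) (ρ : ℝ) :
    ∫⁻ τ : ℝ, jap (49 / 50) (τ + ρ) * ‖fourierT g τ‖ₑ ^ 2 ≤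
      ENNReal.ofReal (4 * T ^ (1 / 50 : ℝ)) *
        ∫⁻ τ : ℝ, jap 1 (τ + ρ) * ‖fourierT g τ‖ₑ ^ 2 := by
  set B := ∫⁻ τ : ℝ, jap 1 (τ + ρ) * ‖fourierT g τ‖ₑ ^ 2 with hB
  have hm : Measurable (fourierT g) := (continuous_fourierT hs hd).measurable
  calc _ ≤ ∫⁻ τ : ℝ, (ENNReal.ofReal (T ^ (1 / 50 : ℝ)) *
          (jap 1 (τ + ρ) * ‖fourierT g τ‖ₑ ^ 2) +
        ENNReal.ofReal (T ^ (-(49 / 50) : ℝ)) * ‖fourierT g τ‖ₑ ^ 2) := by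
        refine lintegral_mono fun τ => ?_
        rw [← mul_assoc, ← add_mul]
        gcongr
        exact jap_le_interpolate hT _
    _ = ENNReal.ofReal (T ^ (1 / 50 : ℝ)) * B +
        ENNReal.ofReal (T ^ (-(49 / 50) : ℝ)) * ∫⁻ τ : ℝ, ‖fourierT g τ‖ₑ ^ 2 := by
        rw [lintegral_add_left (by fun_prop), lintegral_const_mul _ (by fun_prop),
          lintegral_const_mul _ (by fun_prop)]
    _ ≤ ENNReal.ofReal (T ^ (1 / 50 : ℝ)) * B +
        ENNReal.ofReal (T ^ (-(49 / 50) : ℝ)) * (ENNReal.ofReal (3 * T) * B) := by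
        gcongr
        exact lintegral_enorm_sq_fourierT_le hT hg hs hd ρ
    _ = _ := by
        rw [← mul_assoc, ← add_mul, ← ENNReal.ofReal_mul (by positivity),
          ← ENNReal.ofReal_add (by positivity) (by positivity)]
        congr 2
        have : T ^ (-(49 / 50) : ℝ) * T = T ^ (1 / 50 : ℝ) := by
          nth_rewrite 2 [← Real.rpow_one T]
          rw [← Real.rpow_add hT]
          norm_num
        rw [← this]
        ring

/-! ### Duality -/

/-- Testing with `h` itself would give the claim if its norm were known to be finite. Truncations in
height and to sets of finite measure make it finite, so one factor can be cancelled; monotone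
convergence concludes. -/
theorem lintegral_sq_le_of_forall_dual {α : Type*} [MeasurableSpace α] {μ : Measure α}
    [SigmaFinite μ] {h : α → ℝ≥0∞} (hh : Measurable h) {M : ℝ≥0∞}
    (H : ∀ f : α → ℝ≥0∞, Measurable f → (∫⁻ x, f x * h x ∂μ) ^ 2 ≤ M * ∫⁻ x, f x ^ 2 ∂μ) :
    ∫⁻ x, h x ^ 2 ∂μ ≤ M := by
  set f : ℕ → α → ℝ≥0∞ := fun n => (spanningSets μ n).indicator fun x => min (h x) n with hf
  have hfm : ∀ n, Measurable (f n) := fun n =>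
    (hh.min measurable_const).indicator (measurableSet_spanningSets μ n)
  have hfle : ∀ n x, f n x ≤ h x := fun n x =>
    (Set.indicator_le_self' (fun _ _ => zero_le) x).trans (min_le_left _ _)
  have hmono : Monotone f := by
    intro m n hmn x
    simp only [hf]
    by_cases hx : x ∈ spanningSets μ m
    · rw [Set.indicator_of_mem hx, Set.indicator_of_mem (monotone_spanningSets μ hmn hx)]
      gcongr
    · rw [Set.indicator_of_notMem hx]
      exact zero_le
  have hfin : ∀ n, ∫⁻ x, f n x ^ 2 ∂μ ≠ ⊤ := by
    intro n
    refine ne_top_of_le_ne_top (b := (n : ℝ≥0∞) ^ 2 * μ (spanningSets μ n))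
      (ENNReal.mul_ne_top (by finiteness) (measure_spanningSets_lt_top μ n).ne) ?_
    rw [← setLIntegral_const, ← lintegral_indicator (measurableSet_spanningSets μ n)]
    refine lintegral_mono fun x => ?_
    simp only [hf]
    by_cases hx : x ∈ spanningSets μ n
    · rw [Set.indicator_of_mem hx, Set.indicator_of_mem hx]
      gcongr
      exact min_le_right _ _
    · simp [Set.indicator_of_notMem hx]
  have hbound : ∀ n, ∫⁻ x, f n x ^ 2 ∂μ ≤ M := by
    intro n
    set I := ∫⁻ x, f n x ^ 2 ∂μ with hI
    have h1 : I ≤ ∫⁻ x, f n x * h x ∂μ := lintegral_mono fun x => by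
      simp only [sq]
      gcongr
      exact hfle n x
    have h2 : I ^ 2 ≤ M * I := (pow_le_pow_left' h1 2).trans (H _ (hfm n))
    by_cases h0 : I = 0
    · rw [h0]; exact zero_le
    · rw [sq] at h2
      exact (ENNReal.mul_le_mul_iff_left h0 (hfin n)).1 h2
  have hsup : ∀ x, h x ^ 2 = ⨆ n, f n x ^ 2 := by
    intro x
    have ht : Filter.Tendsto (fun n => f n x) Filter.atTop (nhds (h x)) := by
      have hev : ∀ᶠ n : ℕ in Filter.atTop, f n x = min (h x) n := by
        have hx : x ∈ ⋃ n, spanningSets μ n := by rw [iUnion_spanningSets]; trivial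
        obtain ⟨m, hm⟩ := Set.mem_iUnion.1 hx
        filter_upwards [Filter.eventually_ge_atTop m] with n hn
        exact Set.indicator_of_mem (monotone_spanningSets μ hn hm) _
      refine Filter.Tendsto.congr' (hev.mono fun n hn => hn.symm) ?_
      have := (tendsto_const_nhds (x := h x)).min ENNReal.tendsto_nat_nhds_top
      simpa using this
    refine tendsto_nhds_unique (ENNReal.Tendsto.pow (n := 2) ht) (tendsto_atTop_iSup fun m n hmn => ?_)
    exact pow_le_pow_left' (hmono hmn x) 2
  simp_rw [hsup]
  rw [lintegral_iSup (fun n => (hfm n).pow_const 2)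
    (fun m n hmn x => pow_le_pow_left' (hmono hmn x) 2)]
  exact iSup_le hbound

/-! ### Smooth periodic functions with compact support in time -/

/-- Smooth functions of `(t, x)`, periodic in `x` and vanishing for `|t| > T`. -/
structure IsTest (T : ℝ) (f : ℝ → ℝ → ℂ) : Prop where
  smooth : ContDiff ℝ ∞ (fun p : ℝ × ℝ => f p.1 p.2)
  periodic : ∀ t x : ℝ, f t (x + 2 * Real.pi) = f t x
  support : ∀ t x : ℝ, T < |t| → f t x = 0

/-- The derivative in the space variable. -/
def derivX (f : ℝ → ℝ → ℂ) (t x : ℝ) : ℂ := deriv (fun y => f t y) x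

/-- The derivative in the time variable. -/
def derivT (f : ℝ → ℝ → ℂ) (t x : ℝ) : ℂ := deriv (fun s => f s x) t

namespace IsTest

variable {T : ℝ} {f g : ℝ → ℝ → ℂ}

theorem continuous (hf : IsTest T f) : Continuous fun p : ℝ × ℝ => f p.1 p.2 :=
  hf.smooth.continuous

theorem continuous_x (hf : IsTest T f) (t : ℝ) : Continuous (f t) :=
  hf.continuous.comp (f := fun x : ℝ => (t, x)) (by fun_prop)

theorem hasDerivAt_x (hf : IsTest T f) (t x : ℝ) : HasDerivAt (f t) (derivX f t x) x := by
  have : ContDiff ℝ ∞ (f t) := hf.smooth.comp (contDiff_prodMk_right t)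
  exact (this.differentiable (by simp) x).hasDerivAt

theorem hasDerivAt_t (hf : IsTest T f) (t x : ℝ) :
    HasDerivAt (fun s => f s x) (derivT f t x) t := by
  have : ContDiff ℝ ∞ (fun s => f s x) := hf.smooth.comp (contDiff_prodMk_left x)
  exact (this.differentiable (by simp) t).hasDerivAt

theorem mul (hf : IsTest T f) (hg : IsTest T g) : IsTest T fun t x => f t x * g t x where
  smooth := hf.smooth.mul hg.smooth
  periodic t x := by rw [hf.periodic, hg.periodic]
  support t x ht := by rw [hf.support t x ht, zero_mul]

theorem derivX (hf : IsTest T f) : IsTest T (derivX f) where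
  smooth := by
    have hF := hf.smooth.fderiv_right (m := ∞) (by simp)
    have e : (fun p : ℝ × ℝ => PeriodicBourgain.derivX f p.1 p.2) =
        fun p => fderiv ℝ (fun p : ℝ × ℝ => f p.1 p.2) p (0, 1) := by
      ext p
      have h1 := (hf.smooth.differentiable (by simp) p).hasFDerivAt
      have h2 : HasDerivAt (fun y : ℝ => (p.1, y)) ((0 : ℝ), (1 : ℝ)) p.2 :=
        (hasDerivAt_const _ _).prodMk (hasDerivAt_id _)
      exact (HasFDerivAt.comp_hasDerivAt p.2 h1 h2).deriv
    rw [e]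
    exact hF.clm_apply contDiff_const
  periodic t x := by
    have : (fun y => f t (y + 2 * Real.pi)) = f t := funext fun y => hf.periodic t y
    unfold PeriodicBourgain.derivX
    rw [← deriv_comp_add_const, this]
  support t x ht := by
    have : (fun y => f t y) = fun _ => 0 := funext fun y => hf.support t y ht
    unfold PeriodicBourgain.derivX
    rw [this, deriv_const]

theorem derivT (hf : IsTest T f) : IsTest T (derivT f) where
  smooth := by
    have hF := hf.smooth.fderiv_right (m := ∞) (by simp)
    have e : (fun p : ℝ × ℝ => PeriodicBourgain.derivT f p.1 p.2) =
        fun p => fderiv ℝ (fun p : ℝ × ℝ => f p.1 p.2) p (1, 0) := by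
      ext p
      have h1 := (hf.smooth.differentiable (by simp) p).hasFDerivAt
      have h2 : HasDerivAt (fun s : ℝ => (s, p.2)) ((1 : ℝ), (0 : ℝ)) p.1 :=
        (hasDerivAt_id _).prodMk (hasDerivAt_const _ _)
      exact (HasFDerivAt.comp_hasDerivAt p.1 h1 h2).deriv
    rw [e]
    exact hF.clm_apply contDiff_const
  periodic t x := by
    unfold PeriodicBourgain.derivT
    simp_rw [hf.periodic]
  support t x ht := by
    have : (fun s => f s x) =ᶠ[nhds t] fun _ => 0 := by
      have ho : IsOpen {s : ℝ | T < |s|} := isOpen_lt continuous_const continuous_abs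
      filter_upwards [ho.mem_nhds ht] with s hs
      exact hf.support s x hs
    unfold PeriodicBourgain.derivT
    rw [this.deriv_eq, deriv_const]

theorem exists_bound (hf : IsTest T f) : ∃ C : ℝ, ∀ t x, ‖f t x‖ ≤ C := by
  obtain ⟨C, hC⟩ := ((isCompact_Icc (a := -T) (b := T)).prod
    (isCompact_Icc (a := (0 : ℝ)) (b := 2 * Real.pi))).exists_bound_of_continuousOn
    hf.continuous.continuousOn
  refine ⟨max C 0, fun t x => ?_⟩
  by_cases ht : T < |t|
  · rw [hf.support t x ht, norm_zero]
    exact le_max_right _ _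
  · obtain ⟨y, hy, hxy⟩ := Function.Periodic.exists_mem_Ico₀ (f := f t)
      (fun x => hf.periodic t x) Real.two_pi_pos x
    rw [hxy]
    refine le_trans (hC (t, y) ⟨?_, ⟨hy.1, hy.2.le⟩⟩) (le_max_left _ _)
    rw [Set.mem_Icc, ← abs_le]
    exact not_lt.1 ht

theorem norm_exp_kernel (x ξ : ℝ) : ‖Complex.exp (-(Complex.I * (x : ℂ) * (ξ : ℂ)))‖ = 1 := by
  rw [Complex.norm_exp]
  simp

/-! ### Fourier coefficients of test functions: regularity, decay, inversion -/

theorem exists_fourierX_bound (hf : IsTest T f) : ∃ C : ℝ, ∀ t ξ, ‖fourierX (f t) ξ‖ ≤ C := by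
  obtain ⟨C, hC⟩ := hf.exists_bound
  refine ⟨fourierConst * (C * |2 * Real.pi - 0|), fun t ξ => ?_⟩
  unfold fourierX
  rw [norm_mul, Complex.norm_real, Real.norm_of_nonneg (by positivity)]
  refine mul_le_mul_of_nonneg_left ?_ fourierConst_pos.le
  refine intervalIntegral.norm_integral_le_of_norm_le_const fun x _ => ?_
  rw [norm_mul]
  have := norm_exp_kernel x ξ
  rw [Complex.ofReal_intCast] at this
  rw [this, one_mul]
  exact hC t x

theorem hasDerivAt_fourierX (hf : IsTest T f) (ξ : ℤ) (t : ℝ) :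
    HasDerivAt (fun s => fourierX (f s) ξ) (fourierX (PeriodicBourgain.derivT f t) ξ) t := by
  obtain ⟨C, hC⟩ := hf.derivT.exists_bound
  unfold fourierX
  refine HasDerivAt.const_mul _ ?_
  have hE : Continuous fun x : ℝ => Complex.exp (-(Complex.I * (x : ℂ) * (ξ : ℂ))) := by fun_prop
  refine (intervalIntegral.hasDerivAt_integral_of_dominated_loc_of_deriv_le (s := Set.univ)
    (bound := fun _ => C) (F := fun s x => Complex.exp (-(Complex.I * (x : ℂ) * (ξ : ℂ))) * f s x)
    (F' := fun s x => Complex.exp (-(Complex.I * (x : ℂ) * (ξ : ℂ))) *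
      PeriodicBourgain.derivT f s x)
    Filter.univ_mem ?_ ?_ ?_ ?_ ?_ ?_).2
  · exact Filter.Eventually.of_forall fun s => (hE.mul (hf.continuous_x s)).aestronglyMeasurable
  · exact (hE.mul (hf.continuous_x t)).intervalIntegrable _ _
  · exact (hE.mul (hf.derivT.continuous_x t)).aestronglyMeasurable
  · refine Filter.Eventually.of_forall fun x _ s _ => ?_
    have := norm_exp_kernel x ξ
    rw [Complex.ofReal_intCast] at this
    rw [norm_mul, this, one_mul]
    exact hC s x
  · exact intervalIntegrable_const
  · exact Filter.Eventually.of_forall fun x _ s _ => (hf.hasDerivAt_t s x).const_mul _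

theorem deriv_fourierX (hf : IsTest T f) (ξ : ℤ) :
    deriv (fun t => fourierX (f t) ξ) = fun t => fourierX (PeriodicBourgain.derivT f t) ξ :=
  funext fun t => (hf.hasDerivAt_fourierX ξ t).deriv

theorem contDiff_fourierX (hf : IsTest T f) (ξ : ℤ) :
    ContDiff ℝ ∞ fun t => fourierX (f t) ξ := by
  rw [contDiff_infty]
  intro n
  induction n generalizing f with
  | zero =>
    rw [Nat.cast_zero, contDiff_zero]
    exact continuous_iff_continuousAt.2 fun t => (hf.hasDerivAt_fourierX ξ t).continuousAt
  | succ n ih =>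
    rw [Nat.cast_succ, contDiff_succ_iff_deriv]
    refine ⟨fun t => (hf.hasDerivAt_fourierX ξ t).differentiableAt, fun h => ?_, ?_⟩
    · exact absurd h (by simp)
    · rw [hf.deriv_fourierX]
      exact ih hf.derivT

theorem fourierX_eq_zero (hf : IsTest T f) (ξ : ℤ) (t : ℝ) (ht : T < |t|) :
    fourierX (f t) ξ = 0 := by
  have : f t = fun _ => 0 := funext fun x => hf.support t x ht
  simp [fourierX, this]

theorem hasCompactSupport_fourierX (hf : IsTest T f) (ξ : ℤ) :
    HasCompactSupport fun t => fourierX (f t) ξ := by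
  refine HasCompactSupport.intro (isCompact_Icc (a := -T) (b := T)) fun t ht => ?_
  refine hf.fourierX_eq_zero ξ t ?_
  rw [Set.mem_Icc, ← abs_le] at ht
  exact not_le.1 ht

/-- Integration by parts; the boundary terms cancel because both `f t` and the exponential are
`2π`-periodic. -/
theorem fourierX_derivX (hf : IsTest T f) (t : ℝ) (ξ : ℤ) :
    fourierX (PeriodicBourgain.derivX f t) ξ = Complex.I * ξ * fourierX (f t) ξ := by
  have hE : ∀ x : ℝ, HasDerivAt (fun x : ℝ => Complex.exp (-(Complex.I * (x : ℂ) * (ξ : ℂ))))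
      (Complex.exp (-(Complex.I * (x : ℂ) * (ξ : ℂ))) * (-(Complex.I * ξ))) x := by
    intro x
    refine HasDerivAt.cexp ?_
    have h : HasDerivAt (fun y : ℝ => -(Complex.I * (y : ℂ) * (ξ : ℂ)))
        (-(Complex.I * ((1 : ℝ) : ℂ) * (ξ : ℂ))) x :=
      (((hasDerivAt_id x).ofReal_comp.const_mul Complex.I).mul_const (ξ : ℂ)).fun_neg
    simpa using h
  have hEc : Continuous fun x : ℝ => Complex.exp (-(Complex.I * (x : ℂ) * (ξ : ℂ))) := by fun_prop
  have h := intervalIntegral.integral_mul_deriv_eq_deriv_mul (a := 0) (b := 2 * Real.pi)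
    (fun x _ => hE x) (fun x _ => hf.hasDerivAt_x t x)
    ((hEc.mul continuous_const).intervalIntegrable _ _)
    ((hf.derivX.continuous_x t).intervalIntegrable _ _)
  have hper : f t (2 * Real.pi) = f t 0 := by
    have := hf.periodic t 0
    rwa [zero_add] at this
  have hexp : Complex.exp (-(Complex.I * ((2 * Real.pi : ℝ) : ℂ) * (ξ : ℂ))) = 1 := by
    rw [Complex.exp_eq_one_iff]
    refine ⟨-ξ, ?_⟩
    push_cast
    ring
  unfold fourierX
  rw [h, hper, hexp]
  simp only [Complex.ofReal_zero, mul_zero, zero_mul, neg_zero, Complex.exp_zero, sub_self,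
    zero_sub]
  rw [← intervalIntegral.integral_neg, ← intervalIntegral.integral_const_mul,
    ← intervalIntegral.integral_const_mul, ← intervalIntegral.integral_const_mul]
  refine intervalIntegral.integral_congr fun x _ => ?_
  ring

theorem fourierTX_derivT (hf : IsTest T f) (τ : ℝ) (ξ : ℤ) :
    fourierTX (PeriodicBourgain.derivT f) τ ξ = Complex.I * τ * fourierTX f τ ξ := by
  unfold fourierTX
  rw [← hf.deriv_fourierX, fourierT_deriv (hf.hasCompactSupport_fourierX ξ)
    (hf.contDiff_fourierX ξ)]

theorem fourierTX_derivX (hf : IsTest T f) (τ : ℝ) (ξ : ℤ) :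
    fourierTX (PeriodicBourgain.derivX f) τ ξ = Complex.I * ξ * fourierTX f τ ξ := by
  unfold fourierTX fourierT
  simp_rw [hf.fourierX_derivX]
  rw [← integral_const_mul, ← integral_const_mul, ← integral_const_mul]
  refine integral_congr_ae (Filter.Eventually.of_forall fun t => ?_)
  ring

theorem exists_fourierTX_bound (hf : IsTest T f) : ∃ C : ℝ, ∀ τ ξ, ‖fourierTX f τ ξ‖ ≤ C := by
  obtain ⟨C, hC⟩ := hf.exists_fourierX_bound
  refine ⟨fourierConst * ∫ t in Set.Icc (-T) T, C, fun τ ξ => ?_⟩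
  unfold fourierTX fourierT
  rw [norm_mul, Complex.norm_real, Real.norm_of_nonneg (by positivity)]
  refine mul_le_mul_of_nonneg_left ?_ fourierConst_pos.le
  rw [← setIntegral_eq_integral_of_forall_compl_eq_zero (s := Set.Icc (-T) T)]
  · refine norm_integral_le_of_norm_le (integrableOn_const (by simp))
      (Filter.Eventually.of_forall fun t => ?_)
    rw [norm_mul, norm_exp_kernel, one_mul]
    exact hC t ξ
  · intro t ht
    rw [Set.mem_Icc, ← abs_le] at ht
    simp only [hf.fourierX_eq_zero ξ t (not_le.1 ht), mul_zero]

theorem exists_fourierTX_decay (hf : IsTest T f) :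
    ∃ C : ℝ, 0 ≤ C ∧ ∀ τ ξ, ‖fourierTX f τ ξ‖ ≤ C * (bracket ξ ^ (-2 : ℝ) * bracket τ ^ (-2 : ℝ)) := by
  obtain ⟨C₁, h₁⟩ := hf.exists_fourierTX_bound
  obtain ⟨C₂, h₂⟩ := hf.derivT.derivT.exists_fourierTX_bound
  obtain ⟨C₃, h₃⟩ := hf.derivX.derivX.exists_fourierTX_bound
  obtain ⟨C₄, h₄⟩ := hf.derivX.derivX.derivT.derivT.exists_fourierTX_bound
  -- Expanding `(1 + ξ²)(1 + τ²)`, the four products are the moduli of the transforms of `f`,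
  -- `∂ₜ²f`, `∂ₓ²f` and `∂ₜ²∂ₓ²f`.
  have key : ∀ τ ξ, ‖fourierTX f τ ξ‖ * (bracket ξ ^ 2 * bracket τ ^ 2) ≤ C₁ + C₂ + C₃ + C₄ := by
    intro τ ξ
    have g₁ := h₁ τ ξ
    have g₂ := h₂ τ ξ
    have g₃ := h₃ τ ξ
    have g₄ := h₄ τ ξ
    rw [hf.derivT.fourierTX_derivT, hf.fourierTX_derivT] at g₂
    rw [hf.derivX.fourierTX_derivX, hf.fourierTX_derivX] at g₃
    rw [hf.derivX.derivX.derivT.fourierTX_derivT, hf.derivX.derivX.fourierTX_derivT,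
      hf.derivX.fourierTX_derivX, hf.fourierTX_derivX] at g₄
    simp only [norm_mul, Complex.norm_I, one_mul, Complex.norm_real, Complex.norm_intCast,
      Real.norm_eq_abs] at g₂ g₃ g₄
    have eτ : |τ| * |τ| = τ ^ 2 := by rw [← sq, sq_abs]
    have eξ : |(ξ : ℝ)| * |(ξ : ℝ)| = (ξ : ℝ) ^ 2 := by rw [← sq, sq_abs]
    rw [bracket_sq, bracket_sq, ← eτ, ← eξ]
    linarith
  refine ⟨C₁ + C₂ + C₃ + C₄, (by positivity : (0 : ℝ) ≤ _).trans (key 0 0), fun τ ξ => ?_⟩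
  have hb1 := bracket_pos ξ
  have hb2 := bracket_pos τ
  have := key τ ξ
  rw [← le_div_iff₀ (by positivity)] at this
  refine this.trans (le_of_eq ?_)
  rw [Real.rpow_neg hb1.le, Real.rpow_neg hb2.le, Real.rpow_two, Real.rpow_two]
  field_simp

theorem measurable_fourierTX (hf : IsTest T f) :
    Measurable fun p : ℤ × ℝ => fourierTX f p.2 p.1 := by
  refine measurable_from_prod_countable_right fun ξ => ?_
  exact (continuous_fourierT (hf.hasCompactSupport_fourierX ξ) (hf.contDiff_fourierX ξ)).measurable

theorem integrable_fourierTX (hf : IsTest T f) :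
    Integrable (fun p : ℤ × ℝ => fourierTX f p.2 p.1) freqMeasure := by
  obtain ⟨C, hC0, hC⟩ := hf.exists_fourierTX_decay
  refine ⟨hf.measurable_fourierTX.aestronglyMeasurable, ?_⟩
  have h1 : ∀ p : ℤ × ℝ, ‖fourierTX f p.2 p.1‖ₑ ≤
      ENNReal.ofReal C * (jap (-2) p.1 * jap (-2) p.2) := by
    intro p
    have hb1 := bracket_pos p.1
    have hb2 := bracket_pos p.2
    unfold jap
    rw [← ofReal_norm, ← ENNReal.ofReal_mul (by positivity), ← ENNReal.ofReal_mul hC0]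
    exact ENNReal.ofReal_le_ofReal (hC _ _)
  refine lt_of_le_of_lt (lintegral_mono h1) ?_
  rw [lintegral_const_mul _ (by fun_prop), lintegral_freqMeasure (by fun_prop)]
  simp only
  have : ∀ ξ : ℤ, ∫⁻ τ : ℝ, jap (-2) ξ * jap (-2) τ = jap (-2) ξ * ∫⁻ τ : ℝ, jap (-2) τ :=
    fun ξ => lintegral_const_mul _ (by fun_prop)
  simp_rw [this]
  rw [ENNReal.tsum_mul_right]
  have a := (tsum_jap_int_lt_top (p := 2) one_lt_two).ne
  have b := (lintegral_jap_lt_top (p := 2) one_lt_two).ne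
  finiteness

theorem summable_fourierX (hf : IsTest T f) (t : ℝ) : Summable fun ξ : ℤ => fourierX (f t) ξ := by
  obtain ⟨C₁, h₁⟩ := hf.exists_fourierX_bound
  obtain ⟨C₂, h₂⟩ := hf.derivX.derivX.exists_fourierX_bound
  have hs : Summable fun ξ : ℤ => (C₁ + C₂) * (bracket ξ ^ (-2 : ℝ)) := by
    refine Summable.mul_left _ ?_
    have := ENNReal.summable_toReal (tsum_jap_int_lt_top (p := 2) one_lt_two).ne
    refine this.congr fun ξ => ?_
    have hb := bracket_pos ξ
    exact ENNReal.toReal_ofReal (by positivity)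
  refine Summable.of_norm_bounded hs fun ξ => ?_
  have g₁ := h₁ t ξ
  have g₂ := h₂ t ξ
  rw [hf.derivX.fourierX_derivX, hf.fourierX_derivX] at g₂
  simp only [norm_mul, Complex.norm_I, one_mul, Complex.norm_intCast] at g₂
  have hb := bracket_pos ξ
  rw [Real.rpow_neg hb.le, Real.rpow_two, ← div_eq_mul_inv, le_div_iff₀ (by positivity),
    bracket_sq]
  have eξ : |(ξ : ℝ)| * |(ξ : ℝ)| = (ξ : ℝ) ^ 2 := by rw [← sq, sq_abs]
  rw [← eξ]
  linarith

theorem hasSum_fourierX (hf : IsTest T f) (t x : ℝ) :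
    HasSum (fun ξ : ℤ => fourierConst * (Complex.exp (Complex.I * x * ξ) * fourierX (f t) ξ))
      (f t x) := by
  have : Fact (0 < 2 * Real.pi) := ⟨Real.two_pi_pos⟩
  have hper : Function.Periodic (f t) (2 * Real.pi) := fun x => hf.periodic t x
  let F : C(AddCircle (2 * Real.pi), ℂ) :=
    ⟨hper.lift, continuous_coinduced_dom.2 (hf.continuous_x t)⟩
  have hpi : (Real.pi : ℂ) ≠ 0 := by exact_mod_cast Real.pi_ne_zero
  have hcoef : ∀ ξ : ℤ, fourierCoeff F ξ = fourierConst * fourierX (f t) ξ := by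
    intro ξ
    rw [fourierCoeff_eq_intervalIntegral _ _ 0]
    unfold fourierX
    change _ = (fourierConst : ℂ) * ((fourierConst : ℂ) * _)
    rw [← mul_assoc, ← Complex.ofReal_mul, fourierConst_mul_self, Complex.real_smul, zero_add,
      one_div]
    congr 1
    refine intervalIntegral.integral_congr fun x _ => ?_
    simp only [smul_eq_mul]
    rw [fourier_coe_apply]
    congr 2
    push_cast
    field_simp
  have hsum : Summable (fourierCoeff F) := by
    rw [funext hcoef]
    exact (hf.summable_fourierX t).mul_left _
  have h := has_pointwise_sum_fourier_series_of_summable hsum (x : AddCircle (2 * Real.pi))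
  have e : (fun ξ : ℤ => (fourierConst : ℂ) * (Complex.exp (Complex.I * x * ξ) *
      fourierX (f t) ξ)) = fun ξ => fourierCoeff F ξ • fourier ξ (x : AddCircle (2 * Real.pi)) := by
    ext ξ
    have e1 : 2 * (Real.pi : ℂ) * Complex.I * ξ * x / ((2 * Real.pi : ℝ) : ℂ) =
        Complex.I * x * ξ := by
      push_cast
      field_simp
    rw [hcoef, fourier_coe_apply, smul_eq_mul, e1]
    ring
  rw [e]
  exact h

end IsTest

/-! ### Space-time inversion and the transform of a product -/

/-- The character `e^{i(tτ + xξ)}` of frequency `p = (ξ, τ)` at `z = (t, x)`. -/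
def character (p : ℤ × ℝ) (z : ℝ × ℝ) : ℂ :=
  Complex.exp (Complex.I * (z.1 * p.2 + z.2 * p.1))

theorem norm_character (p : ℤ × ℝ) (z : ℝ × ℝ) : ‖character p z‖ = 1 := by
  unfold character
  rw [Complex.norm_exp]
  simp

theorem measurable_character :
    Measurable fun w : (ℤ × ℝ) × (ℝ × ℝ) => character w.1 w.2 := by
  unfold character
  fun_prop

theorem character_sub_mul (p q : ℤ × ℝ) (z : ℝ × ℝ) :
    character (-(p - q)) z = character (-p) z * character q z := by
  unfold character
  rw [← Complex.exp_add]
  congr 1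
  simp only [Prod.fst_neg, Prod.snd_neg, Prod.fst_sub, Prod.snd_sub]
  push_cast
  ring

/-- The measure on one period strip. -/
def stripMeasure : Measure (ℝ × ℝ) :=
  (volume : Measure ℝ).prod (volume.restrict (Set.Ioc 0 (2 * Real.pi)))

instance : SFinite stripMeasure := by unfold stripMeasure; infer_instance

namespace IsTest

variable {T : ℝ} {f w : ℝ → ℝ → ℂ}

theorem integrable_strip (hf : IsTest T f) :
    Integrable (fun z : ℝ × ℝ => f z.1 z.2) stripMeasure := by
  obtain ⟨C, hC⟩ := hf.exists_bound
  rw [← integrableOn_iff_integrable_of_support_subset (s := Set.Icc (-T) T ×ˢ Set.univ)]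
  · refine Measure.integrableOn_of_bounded (M := C) ?_ hf.continuous.aestronglyMeasurable
      (Filter.Eventually.of_forall fun z => hC _ _)
    unfold stripMeasure
    rw [Measure.prod_prod]
    simp [ENNReal.mul_ne_top]
  · intro z hz
    simp only [Set.mem_prod, Set.mem_univ, and_true, Set.mem_Icc, ← abs_le]
    by_contra! hc
    exact hz (hf.support _ _ hc)

theorem integrable_character_mul (hf : IsTest T f) (p : ℤ × ℝ) :
    Integrable (fun z : ℝ × ℝ => character p z * f z.1 z.2) stripMeasure :=
  hf.integrable_strip.bdd_mul (c := 1)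
    (measurable_character.comp (measurable_prodMk_left (x := p))).aestronglyMeasurable
    (Filter.Eventually.of_forall fun z => (norm_character p z).le)

theorem fourierTX_eq_integral (hf : IsTest T f) (p : ℤ × ℝ) :
    fourierTX f p.2 p.1 = fourierConst * (fourierConst *
      ∫ z, character (-p) z * f z.1 z.2 ∂stripMeasure) := by
  have h := hf.integrable_character_mul (-p)
  unfold stripMeasure at h ⊢
  rw [integral_prod _ h]
  unfold fourierTX fourierT
  change (fourierConst : ℂ) * _ = _
  congr 1
  rw [← integral_const_mul]
  refine integral_congr_ae (Filter.Eventually.of_forall fun t => ?_)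
  unfold fourierX
  change _ * ((fourierConst : ℂ) * _) = (fourierConst : ℂ) * _
  rw [mul_left_comm, intervalIntegral.integral_of_le Real.two_pi_pos.le, ← integral_const_mul]
  congr 1
  refine integral_congr_ae (Filter.Eventually.of_forall fun x => ?_)
  unfold character
  simp only
  rw [← mul_assoc, ← Complex.exp_add]
  congr 2
  simp only [Prod.fst_neg, Prod.snd_neg]
  push_cast
  ring

theorem integrable_character_mul_fourierTX (hf : IsTest T f) (z : ℝ × ℝ) :
    Integrable (fun p : ℤ × ℝ => character p z * fourierTX f p.2 p.1) freqMeasure :=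
  hf.integrable_fourierTX.bdd_mul (c := 1)
    (measurable_character.comp (measurable_prodMk_right (y := z))).aestronglyMeasurable
    (Filter.Eventually.of_forall fun p => (norm_character p z).le)

theorem inversion (hf : IsTest T f) (z : ℝ × ℝ) :
    f z.1 z.2 = fourierConst * (fourierConst *
      ∫ p, character p z * fourierTX f p.2 p.1 ∂freqMeasure) := by
  have h := hf.integrable_character_mul_fourierTX z
  unfold freqMeasure at h ⊢
  rw [integral_prod _ h, integral_countable h.integral_prod_left]
  have e : ∀ ξ : ℤ, (fourierConst : ℂ) * ((Measure.count : Measure ℤ).real {ξ} •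
      ∫ τ : ℝ, character (ξ, τ) z * fourierTX f τ ξ) =
      Complex.exp (Complex.I * z.2 * ξ) * fourierX (f z.1) ξ := by
    intro ξ
    have hi := fourierT_inversion (hf.hasCompactSupport_fourierX ξ) (hf.contDiff_fourierX ξ) z.1
    rw [hi]
    have : (Measure.count : Measure ℤ).real {ξ} = 1 := by simp [Measure.real]
    rw [this, one_smul, mul_left_comm]
    congr 1
    refine Eq.trans ?_ (integral_const_mul _ _)
    refine integral_congr_ae (Filter.Eventually.of_forall fun τ => ?_)
    unfold character fourierTX
    simp only
    rw [← mul_assoc, ← Complex.exp_add]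
    congr 2
    ring
  rw [← tsum_mul_left, ← tsum_mul_left]
  simp_rw [e]
  exact (hf.hasSum_fourierX z.1 z.2).tsum_eq.symm

/-- `f` is replaced by its inversion formula and the integrals are exchanged; Fubini applies since
`w` is integrable on the strip and the transform of `f` on the frequency space. -/
theorem fourierTX_mul (hf : IsTest T f) (hw : IsTest T w) (p : ℤ × ℝ) :
    fourierTX (fun t x => f t x * w t x) p.2 p.1 = fourierConst * (fourierConst *
      ∫ q : ℤ × ℝ, fourierTX f q.2 q.1 * fourierTX w (p - q).2 (p - q).1 ∂freqMeasure) := by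
  have hprod : Integrable (Function.uncurry fun (z : ℝ × ℝ) (q : ℤ × ℝ) =>
      character (-(p - q)) z * (w z.1 z.2 * fourierTX f q.2 q.1))
      (stripMeasure.prod freqMeasure) := by
    refine (hw.integrable_strip.mul_prod hf.integrable_fourierTX).bdd_mul (c := 1) ?_ ?_
    · exact (measurable_character.comp (f := fun v : (ℝ × ℝ) × (ℤ × ℝ) => (-(p - v.2), v.1))
        (by fun_prop)).aestronglyMeasurable
    · exact Filter.Eventually.of_forall fun v => (norm_character _ _).le
  rw [(hf.mul hw).fourierTX_eq_integral p]
  congr 2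
  calc ∫ z, character (-p) z * (f z.1 z.2 * w z.1 z.2) ∂stripMeasure
      = ∫ z, ∫ q, fourierConst * (fourierConst * (character (-(p - q)) z *
          (w z.1 z.2 * fourierTX f q.2 q.1))) ∂freqMeasure ∂stripMeasure := by
        refine integral_congr_ae (Filter.Eventually.of_forall fun z => ?_)
        simp only
        rw [hf.inversion z, integral_const_mul, integral_const_mul]
        have : ∀ q : ℤ × ℝ, character (-(p - q)) z * (w z.1 z.2 * fourierTX f q.2 q.1) =
            (character (-p) z * w z.1 z.2) * (character q z * fourierTX f q.2 q.1) := by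
          intro q
          rw [character_sub_mul]
          ring
        simp_rw [this]
        rw [integral_const_mul]
        ring
    _ = ∫ q, ∫ z, fourierConst * (fourierConst * (character (-(p - q)) z *
          (w z.1 z.2 * fourierTX f q.2 q.1))) ∂stripMeasure ∂freqMeasure :=
        integral_integral_swap ((hprod.const_mul _).const_mul _)
    _ = _ := by
        refine integral_congr_ae (Filter.Eventually.of_forall fun q => ?_)
        simp only
        rw [hw.fourierTX_eq_integral (p - q), integral_const_mul, integral_const_mul]
        have : ∀ z : ℝ × ℝ, character (-(p - q)) z * (w z.1 z.2 * fourierTX f q.2 q.1) =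
            fourierTX f q.2 q.1 * (character (-(p - q)) z * w z.1 z.2) := by
          intro z
          ring
        simp_rw [this]
        rw [integral_const_mul]
        ring

theorem enorm_fourierTX_mul_le (hf : IsTest T f) (hw : IsTest T w) (p : ℤ × ℝ) :
    ‖fourierTX (fun t x => f t x * w t x) p.2 p.1‖ₑ ≤
      ∫⁻ q : ℤ × ℝ, ‖fourierTX f q.2 q.1‖ₑ * ‖fourierTX w (p - q).2 (p - q).1‖ₑ ∂freqMeasure := by
  rw [hf.fourierTX_mul hw, ← mul_assoc, ← Complex.ofReal_mul, fourierConst_mul_self, enorm_mul]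
  have h1 : ‖(((2 * Real.pi)⁻¹ : ℝ) : ℂ)‖ₑ ≤ 1 := by
    rw [← ofReal_norm, Complex.norm_real, Real.norm_of_nonneg (by positivity),
      ENNReal.ofReal_le_one]
    refine inv_le_one_of_one_le₀ ?_
    have := Real.pi_gt_three
    linarith
  calc _ ≤ 1 * _ := mul_le_mul_left h1 _
    _ ≤ _ := by
      rw [one_mul]
      refine (enorm_integral_le_lintegral_enorm _).trans (le_of_eq ?_)
      refine lintegral_congr fun q => ?_
      rw [enorm_mul]

/-- The transform of the nonlinearity is controlled by a convolution. -/
theorem enorm_fourierTX_nonlinearity_le {u₁ u₂ u₃ : ℝ → ℝ → ℂ} (h₁ : IsTest T u₁)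
    (h₂ : IsTest T u₂) (h₃ : IsTest T u₃) (p₀ : ℤ × ℝ) :
    ‖fourierTX (fun t x => u₁ t x * u₂ t x * deriv (fun y => u₃ t y) x) p₀.2 p₀.1‖ₑ ≤
      ∫⁻ p₁ : ℤ × ℝ, ∫⁻ p₂ : ℤ × ℝ, ‖fourierTX u₁ p₁.2 p₁.1‖ₑ * (‖fourierTX u₂ p₂.2 p₂.1‖ₑ *
        (ENNReal.ofReal |((p₁ + p₂ - p₀).1 : ℝ)| *
          ‖fourierTX u₃ (-(p₁ + p₂ - p₀)).2 (-(p₁ + p₂ - p₀)).1‖ₑ)) ∂freqMeasure ∂freqMeasure := by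
  have e : (fun t x => u₁ t x * u₂ t x * deriv (fun y => u₃ t y) x) =
      fun t x => u₁ t x * (u₂ t x * PeriodicBourgain.derivX u₃ t x) := by
    ext t x
    rw [mul_assoc]
    rfl
  rw [e]
  refine (h₁.enorm_fourierTX_mul_le (h₂.mul h₃.derivX) p₀).trans ?_
  refine lintegral_mono fun p₁ => ?_
  rw [lintegral_const_mul' _ _ (by finiteness)]
  refine mul_le_mul_right ((h₂.enorm_fourierTX_mul_le h₃.derivX (p₀ - p₁)).trans ?_) _
  refine lintegral_mono fun p₂ => ?_
  refine mul_le_mul_right (le_of_eq ?_) _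
  rw [h₃.fourierTX_derivX, enorm_mul, enorm_mul]
  -- The convolution places `u₃` at `p₀ - p₁ - p₂`, which is `-p₃`.
  have e2 : -(p₁ + p₂ - p₀) = p₀ - p₁ - p₂ := by abel
  have e3 : |((p₁ + p₂ - p₀).1 : ℝ)| = |((p₀ - p₁ - p₂).1 : ℝ)| := by
    rw [← e2, Prod.fst_neg, Int.cast_neg, abs_neg]
  rw [e2, e3]
  congr 1
  rw [← ofReal_norm, ← ofReal_norm, Complex.norm_I, Complex.norm_intCast, ENNReal.ofReal_one,
    one_mul]

end IsTest

theorem IsSPer.isTest {T : ℝ} {f : ℝ → ℝ → ℂ} (hf : IsSPer f)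
    (hs : tsupport (fun p : ℝ × ℝ => f p.1 p.2) ⊆ {p | |p.1| ≤ T}) : IsTest T f where
  smooth := hf.smooth
  periodic := hf.periodic
  support t x ht := by
    have : (t, x) ∉ tsupport (fun p : ℝ × ℝ => f p.1 p.2) := fun h =>
      absurd (hs h) (not_le.2 ht)
    exact image_eq_zero_of_notMem_tsupport (f := fun p : ℝ × ℝ => f p.1 p.2) this

/-! ### Norms -/

/-- The absolute value of the space-time Fourier transform as a function on the frequency space. -/
def absFourier (f : ℝ → ℝ → ℂ) (p : ℤ × ℝ) : ℝ≥0∞ := ‖fourierTX f p.2 p.1‖ₑ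

theorem IsTest.measurable_absFourier {T : ℝ} {f : ℝ → ℝ → ℂ} (hf : IsTest T f) :
    Measurable (absFourier f) := hf.measurable_fourierTX.enorm

theorem ofReal_weight_eq (s b x y : ℝ) (v : ℂ) :
    ENNReal.ofReal (bracket x ^ (2 * s) * bracket y ^ (2 * b) * ‖v‖ ^ 2) =
      (jap s x * jap b y * ‖v‖ₑ) ^ 2 := by
  have hx := bracket_pos x
  have hy := bracket_pos y
  rw [mul_pow, mul_pow, jap_pow_two, jap_pow_two, ENNReal.ofReal_mul (by positivity),
    ENNReal.ofReal_mul (by positivity), ENNReal.ofReal_pow (norm_nonneg _), ofReal_norm]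
  rfl

theorem normX_eq {T : ℝ} {f : ℝ → ℝ → ℂ} (hf : IsTest T f) (s b : ℝ) :
    normX s b f =
      sqNorm (fun p => jap s p.1 * jap b (modulation p) * absFourier f p) ^ (1 / 2 : ℝ) := by
  have := hf.measurable_absFourier
  unfold normX sqNorm
  rw [lintegral_freqMeasure (by fun_prop)]
  simp_rw [ofReal_weight_eq]
  rfl

/-- The reflection `p ↦ -p` sends `τ - ξ²` to `-(τ + ξ²)`, so the reflected transform is measured
with the common modulation. -/
theorem normXMinus_eq {T : ℝ} {f : ℝ → ℝ → ℂ} (hf : IsTest T f) (s b : ℝ) :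
    normXMinus s b f =
      sqNorm (fun p => jap s p.1 * jap b (modulation p) * absFourier f (-p)) ^ (1 / 2 : ℝ) := by
  have := hf.measurable_absFourier
  unfold normXMinus sqNorm
  rw [← lintegral_neg_eq_self, lintegral_freqMeasure (by fun_prop)]
  simp_rw [ofReal_weight_eq]
  congr 1
  refine tsum_congr fun ξ => lintegral_congr fun τ => ?_
  rw [neg_neg, ← jap_neg_arg b, ← jap_neg_arg s]
  simp only [modulation, Prod.neg_mk]
  push_cast
  congr 4
  ring

/-- The gain in time is applied for each `ξ` with centre `-ξ²`; the squared modulation weight has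
exponent `2(1/2 - 1/100) = 49/50`. -/
theorem sqNorm_gain {T : ℝ} (hT : 0 < T) {f : ℝ → ℝ → ℂ} (hf : IsTest T f) :
    sqNorm (fun p => jap (-(1 / 100)) (modulation p) *
        (jap (1 / 2) p.1 * jap (1 / 2) (modulation p) * absFourier f p)) ≤
      ENNReal.ofReal (4 * T ^ (1 / 50 : ℝ)) *
        sqNorm (fun p => jap (1 / 2) p.1 * jap (1 / 2) (modulation p) * absFourier f p) := by
  have hm := hf.measurable_absFourier
  unfold sqNorm
  rw [lintegral_freqMeasure (by fun_prop), lintegral_freqMeasure (by fun_prop),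
    ← ENNReal.tsum_mul_left]
  refine ENNReal.tsum_le_tsum fun ξ => ?_
  have h := lintegral_jap_fourierT_gain hT (hf.fourierX_eq_zero ξ)
    (hf.hasCompactSupport_fourierX ξ) (hf.contDiff_fourierX ξ) ((ξ : ℝ) ^ 2)
  have e1 : ∀ τ : ℝ, (jap (-(1 / 100)) (modulation (ξ, τ)) * (jap (1 / 2) ξ *
      jap (1 / 2) (modulation (ξ, τ)) * absFourier f (ξ, τ))) ^ 2 =
      jap 1 ξ * (jap (49 / 50) (τ + (ξ : ℝ) ^ 2) *
        ‖fourierT (fun t => fourierX (f t) ξ) τ‖ₑ ^ 2) := by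
    intro τ
    have : jap (49 / 50) (τ + (ξ : ℝ) ^ 2) = jap (2 * -(1 / 100)) (τ + (ξ : ℝ) ^ 2) *
        jap (2 * (1 / 2)) (τ + (ξ : ℝ) ^ 2) := by
      rw [← jap_add]; norm_num
    rw [this]
    simp only [mul_pow, jap_pow_two, modulation, absFourier, fourierTX]
    norm_num only
    ring
  have e2 : ∀ τ : ℝ, (jap (1 / 2) ξ *
      jap (1 / 2) (modulation (ξ, τ)) * absFourier f (ξ, τ)) ^ 2 =
      jap 1 ξ * (jap 1 (τ + (ξ : ℝ) ^ 2) *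
        ‖fourierT (fun t => fourierX (f t) ξ) τ‖ₑ ^ 2) := by
    intro τ
    simp only [mul_pow, jap_pow_two, modulation, absFourier, fourierTX]
    norm_num only
    ring
  simp only [e1, e2]
  rw [lintegral_const_mul' _ _ (jap_ne_top _ _), lintegral_const_mul' _ _ (jap_ne_top _ _),
    mul_left_comm]
  gcongr

theorem exists_sqNorm_nonlinearity_le :
    ∃ C : ℝ≥0∞, C ≠ ⊤ ∧ ∀ T : ℝ, 0 < T → ∀ u₁ u₂ u₃ : ℝ → ℝ → ℂ,
      IsTest T u₁ → IsTest T u₂ → IsTest T u₃ →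
      sqNorm (fun p => jap (1 / 2) p.1 * jap (-(1 / 2)) (modulation p) *
        absFourier (fun t x => u₁ t x * u₂ t x * deriv (fun y => u₃ t y) x) p) ≤
      C * ENNReal.ofReal (4 * T ^ (1 / 50 : ℝ)) *
        (sqNorm (fun p => jap (1 / 2) p.1 * jap (1 / 2) (modulation p) * absFourier u₁ p) *
        sqNorm (fun p => jap (1 / 2) p.1 * jap (1 / 2) (modulation p) * absFourier u₂ p) *
        sqNorm (fun p => jap (1 / 2) p.1 * jap (1 / 2) (modulation p) * absFourier u₃ (-p))) := by
  obtain ⟨C, hC, hb⟩ := gainKernel_fullKernel.bound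
  refine ⟨C, hC, fun T hT u₁ u₂ u₃ h₁ h₂ h₃ => ?_⟩
  have m₁ := h₁.measurable_absFourier
  have m₂ := h₂.measurable_absFourier
  have m₃ := h₃.measurable_absFourier
  have m : Measurable (absFourier fun t x => u₁ t x * u₂ t x * deriv (fun y => u₃ t y) x) :=
    ((h₁.mul h₂).mul h₃.derivX).measurable_absFourier
  refine lintegral_sq_le_of_forall_dual (by fun_prop) fun f₀ h₀ => ?_
  have key := hb (ENNReal.ofReal (4 * T ^ (1 / 50 : ℝ))) f₀
    (fun p => jap (1 / 2) p.1 * jap (1 / 2) (modulation p) * absFourier u₁ p)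
    (fun p => jap (1 / 2) p.1 * jap (1 / 2) (modulation p) * absFourier u₂ p)
    (fun p => jap (1 / 2) p.1 * jap (1 / 2) (modulation p) * absFourier u₃ (-p))
    h₀ (by fun_prop) (by fun_prop) (by fun_prop) (sqNorm_gain hT h₁) (sqNorm_gain hT h₂)
  refine le_trans (pow_le_pow_left' ?_ 2) (key.trans (le_of_eq (by unfold sqNorm; ring)))
  unfold quadForm
  refine lintegral_mono fun p₀ => ?_
  have inv : ∀ s : ℝ, jap (1 / 2) s * jap (-(1 / 2)) s = 1 := fun s => by
    rw [← jap_add]; simp [jap_zero]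
  have hw : f₀ p₀ * (jap (1 / 2) p₀.1 * jap (-(1 / 2)) (modulation p₀)) *
      (∫⁻ p₁ : ℤ × ℝ, ∫⁻ p₂ : ℤ × ℝ, absFourier u₁ p₁ * (absFourier u₂ p₂ *
        (ENNReal.ofReal |((p₁ + p₂ - p₀).1 : ℝ)| * absFourier u₃ (-(p₁ + p₂ - p₀))))
        ∂freqMeasure ∂freqMeasure) =
      ∫⁻ p₁ : ℤ × ℝ, ∫⁻ p₂ : ℤ × ℝ,
        f₀ p₀ * (jap (1 / 2) p₀.1 * jap (-(1 / 2)) (modulation p₀)) *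
        (absFourier u₁ p₁ * (absFourier u₂ p₂ *
        (ENNReal.ofReal |((p₁ + p₂ - p₀).1 : ℝ)| * absFourier u₃ (-(p₁ + p₂ - p₀)))))
        ∂freqMeasure ∂freqMeasure := by
    have hm : Measurable fun z : (ℤ × ℝ) × (ℤ × ℝ) => absFourier u₁ z.1 * (absFourier u₂ z.2 *
        (ENNReal.ofReal |((z.1 + z.2 - p₀).1 : ℝ)| * absFourier u₃ (-(z.1 + z.2 - p₀)))) := by
      fun_prop
    refine (lintegral_const_mul _ hm.lintegral_prod_right').symm.trans ?_
    refine lintegral_congr fun p₁ => ?_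
    exact (lintegral_const_mul _ (hm.comp measurable_prodMk_left)).symm
  calc _ ≤ f₀ p₀ * (jap (1 / 2) p₀.1 * jap (-(1 / 2)) (modulation p₀)) * _ := by
        rw [mul_assoc (f₀ p₀)]
        exact mul_le_mul_right (mul_le_mul_right
          (IsTest.enorm_fourierTX_nonlinearity_le h₁ h₂ h₃ p₀) _) _
    _ = _ := hw
    _ = _ := by
        refine lintegral_congr fun p₁ => lintegral_congr fun p₂ => ?_
        unfold fullKernel multiplier
        set q := p₁ + p₂ - p₀
        -- Each of `p₁`, `p₂`, `p₃` receives factors `⟨·⟩^(1/2) ⟨·⟩^(-1/2) = 1` in frequency and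
        -- modulation: one half completes the norms, the other builds `fullKernel`.
        calc _ = f₀ p₀ * (jap (1 / 2) p₀.1 * jap (-(1 / 2)) (modulation p₀)) *
            (absFourier u₁ p₁ * (absFourier u₂ p₂ *
              (ENNReal.ofReal |(q.1 : ℝ)| * absFourier u₃ (-q)))) *
            ((jap (1 / 2) (p₁.1 : ℝ) * jap (-(1 / 2)) (p₁.1 : ℝ)) *
            (jap (1 / 2) (p₂.1 : ℝ) * jap (-(1 / 2)) (p₂.1 : ℝ)) *
            (jap (1 / 2) (q.1 : ℝ) * jap (-(1 / 2)) (q.1 : ℝ)) *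
            (jap (1 / 2) (modulation p₁) * jap (-(1 / 2)) (modulation p₁)) *
            (jap (1 / 2) (modulation p₂) * jap (-(1 / 2)) (modulation p₂)) *
            (jap (1 / 2) (modulation q) * jap (-(1 / 2)) (modulation q))) := by
              simp only [inv, mul_one]
          _ = _ := by ring

end PeriodicBourgain

end

/-! ### The trilinear estimate -/

theorem theorem2 :
    ∃ c ε : ℝ, 0 < c ∧ 0 < ε ∧
      ∀ T : ℝ, 0 < T → T ≤ 1 →
        ∀ u₁ u₂ u₃ : ℝ → ℝ → ℂ,
          PeriodicBourgain.IsSPer u₁ → PeriodicBourgain.IsSPer u₂ → PeriodicBourgain.IsSPer u₃ →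
          tsupport (fun p : ℝ × ℝ => u₁ p.1 p.2) ⊆ {p | |p.1| ≤ T} →
          tsupport (fun p : ℝ × ℝ => u₂ p.1 p.2) ⊆ {p | |p.1| ≤ T} →
          tsupport (fun p : ℝ × ℝ => u₃ p.1 p.2) ⊆ {p | |p.1| ≤ T} →
          PeriodicBourgain.normX (1 / 2) (-(1 / 2))
              (fun t x => u₁ t x * u₂ t x * deriv (fun y => u₃ t y) x) ≤
            ENNReal.ofReal (c * T ^ ε) *
              PeriodicBourgain.normX (1 / 2) (1 / 2) u₁ *
              PeriodicBourgain.normX (1 / 2) (1 / 2) u₂ *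
              PeriodicBourgain.normXMinus (1 / 2) (1 / 2) u₃ := by
  obtain ⟨C, hC, hb⟩ := PeriodicBourgain.exists_sqNorm_nonlinearity_le
  -- Both constants are square roots of those in the squared estimate, `4C T^(1/50)`; the added 1
  -- keeps `c` positive when `C = 0`.
  refine ⟨(4 * (C.toReal + 1)) ^ (1 / 2 : ℝ), 1 / 100, by positivity, by norm_num, ?_⟩
  intro T hT _ u₁ u₂ u₃ s₁ s₂ s₃ t₁ t₂ t₃
  have h₁ := s₁.isTest t₁
  have h₂ := s₂.isTest t₂
  have h₃ := s₃.isTest t₃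
  have hprod : PeriodicBourgain.IsTest T fun t x => u₁ t x * u₂ t x * deriv (fun y => u₃ t y) x :=
    (h₁.mul h₂).mul h₃.derivX
  rw [PeriodicBourgain.normX_eq hprod, PeriodicBourgain.normX_eq h₁, PeriodicBourgain.normX_eq h₂,
    PeriodicBourgain.normXMinus_eq h₃]
  have hconst : C * ENNReal.ofReal (4 * T ^ (1 / 50 : ℝ)) ≤
      ENNReal.ofReal (4 * (C.toReal + 1) * T ^ (1 / 50 : ℝ)) := by
    conv_lhs => rw [← ENNReal.ofReal_toReal hC]
    rw [← ENNReal.ofReal_mul ENNReal.toReal_nonneg]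
    refine ENNReal.ofReal_le_ofReal ?_
    have : 0 < T ^ (1 / 50 : ℝ) := Real.rpow_pos_of_pos hT _
    nlinarith
  have e : ENNReal.ofReal ((4 * (C.toReal + 1)) ^ (1 / 2 : ℝ) * T ^ (1 / 100 : ℝ)) =
      ENNReal.ofReal (4 * (C.toReal + 1) * T ^ (1 / 50 : ℝ)) ^ (1 / 2 : ℝ) := by
    rw [ENNReal.ofReal_rpow_of_nonneg (by positivity) (by norm_num),
      Real.mul_rpow (x := 4 * (C.toReal + 1)) (by positivity) (by positivity),
      ← Real.rpow_mul hT.le]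
    norm_num
  rw [e, ← ENNReal.mul_rpow_of_nonneg _ _ (by norm_num), ← ENNReal.mul_rpow_of_nonneg _ _
    (by norm_num), ← ENNReal.mul_rpow_of_nonneg _ _ (by norm_num)]
  refine ENNReal.rpow_le_rpow ?_ (by norm_num)
  refine (hb T hT u₁ u₂ u₃ h₁ h₂ h₃).trans ?_
  rw [mul_assoc (ENNReal.ofReal _), mul_assoc (ENNReal.ofReal _)]
  gcongr
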